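/- \textbf{Model.} Fix $p_s\in(0,1]$, $\tau\in(0,1)$, $v,w,a,b>0$. In round $n$ of channel probing, a link succeeds in contention after $K_n$ slots of duration $\tau$, with $P(K_n=k)=(1-p_s)^{k-1}p_s$, $k\ge 1$. Its first-level channel estimate is $\hat h_n\sim\mathcal{CN}(0,v)$ and its refined (second-level) estimate is $\hat h_n+e_n$ with $e_n\sim\mathcal{CN}(0,w)$; the corresponding rates are $R^{(1)}_n=a|\hat h_n|^2$ and $R^{(2)}_n=b|\hat h_n+e_n|^2$. The variables $K_n,\hat h_n,e_n$ are independent and the rounds are i.i.d. A constant transmission rate $r>0$ is fixed in advance. Having observed $R^{(1)}_n$ (and the past), the receiver feeds back ``1'' (transmit at rate $r$ for one unit of time; the data are received iff $R_n^{(1)}\ge r$), ``0'' (give up and re-contend), or ``e'' (spend an additional time $\tau$ to obtain $R^{(2)}_n$, and then feed back ``1'', transmit at rate $r$ for time $1-\tau$, the data being received iff $R^{(2)}_n\ge r$, or ``0'', re-contend). The process ends with the first transmission. The throughput of a policy is $E[\text{data received}]/E[\text{total time}]$, where the total time is made up of contention, second-level probing and transmission, and policies are required to have finite expected total time. Let $\gamma^*(r)$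 be the supremum of the throughput over all policies at rate $r$, and $\hat\gamma(r)$ the supremum over the policies that never feed back ``e''. Let $G(\cdot\,|\,x)$ be the conditional cdf of $R^{(2)}$ given $R^{(1)}=x$ (the law of $|\sqrt{bx/a}+z|^2$ with $z\sim\mathcal{CN}(0,bw)$), $F$ the cdf of $R^{(1)}$, and \[V_\gamma(x,r)=(1-\tau)(r-\gamma)\bigl(1-G(r|x)\bigr)-\gamma\tau .\] \textbf{Theorem.} The equation $\left(\frac{r}{E[R^{(1)}]}-1\right)e^{r/E[R^{(1)}]}=\frac{p_s}{\tau}$ has exactly one solution $\hat R_1>0$; it maximizes $\hat\gamma$ over $r>0$, and $\hat\gamma(\hat R_1)=\hat R_1e^{-\hat R_1/E[R^{(1)}]}\big/\bigl(\tfrac{\tau}{p_s}+e^{-\hat R_1/E[R^{(1)}]}\bigr)$. The function $\gamma^*$ attains its maximum $\gamma^*_{max}$ over $r>0$, and for every maximizer $R_1^*$ at least one of the following holds. \textbf{[Strategy A]} There is $x_v^*\in[0,R_1^*]$ such that, for $x\ge0$, $V_{\gamma^*_{max}}(x,R_1^*)\ge 0$ iff $x\ge x_v^*$, where $V_{\gamma^*_{max}}(x_v^*,R_1^*)=0$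 unless $x_v^*=0$ and $V_{\gamma^*_{max}}(0,R_1^*)>0$; and it is optimal to use the rate $R_1^*$ and to feed back ``1'' if $R^{(1)}_n\ge R_1^*$, ``0'' if $R^{(1)}_n<x_v^*$, and ``e'' if $R_n^{(1)}\in[x_v^*,R_1^*)$, followed by ``1'' if $R_n^{(2)}\ge R_1^*$ and by ``0'' if $R_n^{(2)}<R_1^*$. The throughput is $\gamma^*_{max}$, and with $I=\int_{x_v^*}^{R_1^*}(1-G(R_1^*|u))\,dF(u)$, \[\gamma^*_{max}=\frac{(1-\tau)R_1^*I+R_1^*e^{-R_1^*/E[R^{(1)}]}}{(1-\tau)\bigl(I+e^{-R_1^*/E[R^{(1)}]}\bigr)+\tau\bigl(\frac1{p_s}+e^{-x_v^*/E[R^{(1)}]}\bigr)} .\] \textbf{[Strategy B]} $R_1^*=\hat R_1$, there is never a need to perform second-level probing, and it is optimal to use the rate $\hat R_1$ and to feed back ``1'' if $R_n^{(1)}\ge\hat R_1$ and ``0'' if $R_n^{(1)}<\hat R_1$. The throughput is $\hat\gamma(\hat R_1)$. Here a policy (with its rate) is optimal if its throughput is the largest among all policies at all rates $r>0$; moreover,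 with $\gamma$ the optimal throughput and $r$ the rate of the strategy, its first-level feedback maximizes for every $R^{(1)}=x\ge0$ the net reward among $0$ (for ``0''), $r\,\mathbf 1(x\ge r)-\gamma$ (for ``1'') and $V_\gamma(x,r)$ (for ``e''), and under Strategy B the net reward of ``e'' is strictly smaller than that of the feedback used. -/

import Mathlib

open MeasureTheory ProbabilityTheory
open scoped ENNReal

noncomputable section

namespace DOS

/-- The circularly symmetric complex Gaussian law `CN(0, v)`: independent real and imaginary
parts, each centred Gaussian with variance `v / 2`. -/
def complexGaussian (v : ℝ) : Measure ℂ :=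
  ((gaussianReal 0 (v / 2).toNNReal).prod (gaussianReal 0 (v / 2).toNNReal)).map
    Complex.measurableEquivRealProd.symm

/-- Parameters of distributed opportunistic scheduling with two-level probing.
The transmission duration is normalised to `T = 1`. -/
structure Params where
  /-- probability `p_s` that a contention slot is successful -/
  ps : unitInterval
  ps_pos : 0 < ps
  /-- slot duration, also the duration of a second-level probing -/
  τ : ℝ
  τ_pos : 0 < τ
  τ_lt_one : τ < 1
  /-- `v`: variance of the first-level channel estimate -/
  v : ℝ
  v_pos : 0 < v
  /-- `w`: variance of the refinement brought by the second-level estimate -/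
  w : ℝ
  w_pos : 0 < w
  /-- `a`, `b`: ratio of rate to squared modulus of the channel estimate at the first and at the
  second level (bandwidth times SNR times back-off factor) -/
  a : ℝ
  a_pos : 0 < a
  b : ℝ
  b_pos : 0 < b

/-- The law of the number of slots until the first successful contention, with values
in `{1, 2, …}` and `P(K = k) = (1 - p_s) ^ (k - 1) * p_s`. -/
def Params.slotLaw (P : Params) : Measure ℕ := (geometricMeasure P.ps).map Nat.succ

/-- The probing process on a probability space: round `n` consists of its number of slots `K n`,
the first-level channel estimate `h n` and the refinement `e n`, so that the second-level
estimate is `h n + e n`. These three are independent, and the rounds are i.i.d. -/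
structure Probing (P : Params) {Ω : Type*} [MeasurableSpace Ω] (μ : Measure Ω) where
  K : ℕ → Ω → ℕ
  h : ℕ → Ω → ℂ
  e : ℕ → Ω → ℂ
  measurable_K : ∀ n, Measurable (K n)
  measurable_h : ∀ n, Measurable (h n)
  measurable_e : ∀ n, Measurable (e n)
  law : ∀ n, μ.map (fun ω => (K n ω, h n ω, e n ω)) =
    P.slotLaw.prod ((complexGaussian P.v).prod (complexGaussian P.w))
  indep : iIndepFun (fun n ω => (K n ω, h n ω, e n ω)) μ

/-- The feedback alphabet: `nack` is "0" (defer and re-contend), `ack` is "1" (transmit),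
`erasure` is "e" (perform a second-level probing). -/
inductive Feedback
  | nack
  | ack
  | erasure

instance : MeasurableSpace Feedback := ⊤

/-- A scheduling policy. In round `n`, `first` gives the feedback from what was observed in the
rounds `0, …, n - 1` and from the pair `(K n, R⁽¹⁾ n)`; if that feedback is `erasure`, `second`
decides from the past and from `(K n, R⁽¹⁾ n, R⁽²⁾ n)` whether to transmit (`true`) or to
re-contend (`false`). The past may be used freely, so the decision sequences
`φ n (R⁽¹⁾ n)`, `ψ n (R⁽²⁾ n)` are a special case. -/
structure Policy where
  first : (n : ℕ) → (Fin n → ℕ × ℝ × ℝ) × ℕ × ℝ → Feedback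
  second : (n : ℕ) → (Fin n → ℕ × ℝ × ℝ) × ℕ × ℝ × ℝ → Bool
  measurable_first : ∀ n, Measurable (first n)
  measurable_second : ∀ n, Measurable (second n)

namespace Probing

variable {P : Params} {Ω : Type*} [MeasurableSpace Ω] {μ : Measure Ω} (M : Probing P μ)

/-- The rate `R⁽¹⁾` after the first-level probing of round `n`. -/
def R1 (n : ℕ) (ω : Ω) : ℝ := P.a * ‖M.h n ω‖ ^ 2

/-- The rate `R⁽²⁾` after the second-level probing of round `n`. -/
def R2 (n : ℕ) (ω : Ω) : ℝ := P.b * ‖M.h n ω + M.e n ω‖ ^ 2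

/-- `E[R⁽¹⁾]`. -/
def meanR1 : ℝ := ∫ ω, M.R1 0 ω ∂μ

def past (n : ℕ) (ω : Ω) : Fin n → ℕ × ℝ × ℝ :=
  fun j => (M.K j ω, M.R1 j ω, M.R2 j ω)

def firstFeedback (π : Policy) (n : ℕ) (ω : Ω) : Feedback :=
  π.first n (M.past n ω, M.K n ω, M.R1 n ω)

def secondFeedback (π : Policy) (n : ℕ) (ω : Ω) : Bool :=
  π.second n (M.past n ω, M.K n ω, M.R1 n ω, M.R2 n ω)

/-- Data are transmitted in round `n` if that round is reached. -/
def Transmits (π : Policy) (n : ℕ) (ω : Ω) : Prop :=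
  M.firstFeedback π n ω = .ack ∨
    (M.firstFeedback π n ω = .erasure ∧ M.secondFeedback π n ω = true)

/-- Round `n` is reached, that is `n ≤ N`, where `N` is the first round with a transmission. -/
def Reached (π : Policy) (n : ℕ) (ω : Ω) : Prop := ∀ j < n, ¬ M.Transmits π j ω

open Classical in
/-- Amount of data received in round `n`, if it is reached, at the fixed transmission rate `r`.
A transmission lasts `1` after "1" and `1 - τ` after "e" and "1"; it is received iff the rate
estimate on which it is based supports `r`. -/
def roundData (π : Policy) (r : ℝ) (n : ℕ) (ω : Ω) : ℝ :=
  match M.firstFeedback π n ω with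
  | .nack => 0
  | .ack => if r ≤ M.R1 n ω then r else 0
  | .erasure =>
      if M.secondFeedback π n ω = true ∧ r ≤ M.R2 n ω then (1 - P.τ) * r else 0

/-- System time spent in round `n`, if it is reached: contention, second-level probing and data
transmission. -/
def roundTime (π : Policy) (n : ℕ) (ω : Ω) : ℝ :=
  M.K n ω * P.τ +
    match M.firstFeedback π n ω with
    | .nack => 0
    | .ack => 1
    | .erasure => P.τ + if M.secondFeedback π n ω = true then 1 - P.τ else 0

open Classical in
/-- The total amount of data received, `R_N T_{d,N}`. -/
def totalData (π : Policy) (r : ℝ) (ω : Ω) : ℝ≥0∞ :=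
  ∑' n : ℕ, if M.Reached π n ω then ENNReal.ofReal (M.roundData π r n ω) else 0

open Classical in
/-- The total system time `T_N`, which is infinite if no transmission ever takes place. -/
def totalTime (π : Policy) (ω : Ω) : ℝ≥0∞ :=
  ∑' n : ℕ, if M.Reached π n ω then ENNReal.ofReal (M.roundTime π n ω) else 0

/-- The stopping rule of the policy lies in `Q`: its expected total time is finite. -/
def Admissible (π : Policy) : Prop := ∫⁻ ω, M.totalTime π ω ∂μ < ∞

/-- The rate of return `E[R_N T_{d,N}] / E[T_N]` at the transmission rate `r`. -/
def throughput (π : Policy) (r : ℝ) : ℝ :=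
  (∫⁻ ω, M.totalData π r ω ∂μ).toReal / (∫⁻ ω, M.totalTime π ω ∂μ).toReal

/-- Throughputs of the admissible two-level policies at the transmission rate `r`. -/
def achievable (r : ℝ) : Set ℝ := {γ | ∃ π, M.Admissible π ∧ M.throughput π r = γ}

/-- Throughputs of the admissible one-level policies (which never feed back "e") at the
transmission rate `r`. -/
def achievableOne (r : ℝ) : Set ℝ :=
  {γ | ∃ π, (∀ n x, π.first n x ≠ .erasure) ∧ M.Admissible π ∧ M.throughput π r = γ}

/-- `γ*`, the optimal throughput of two-level probing at the transmission rate `r`. -/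
def gammaStar (r : ℝ) : ℝ := sSup (M.achievable r)

/-- `γ̂`, the optimal throughput of one-level probing at the transmission rate `r`. -/
def gammaHat (r : ℝ) : ℝ := sSup (M.achievableOne r)

/-- Throughputs of all admissible two-level policies at all transmission rates. -/
def achievableAll : Set ℝ := {γ | ∃ r, 0 < r ∧ γ ∈ M.achievable r}

end Probing

/-- `c_r`, with `E[R⁽²⁾ | R⁽¹⁾] = c_r R⁽¹⁾ + R_e`. -/
def Params.cr (P : Params) : ℝ := P.b / P.a

/-- `R_e`, the expected rate gain of the second-level probing. -/
def Params.Re (P : Params) : ℝ := P.b * P.w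

/-- `G(y | x)`, the conditional cdf of `R⁽²⁾` given `R⁽¹⁾ = x`: the (scaled) non-central `χ²` law
with two degrees of freedom, that is the law of `|√(c_r x) + z|²` with `z ∼ CN(0, R_e)`. -/
def Params.G (P : Params) (y x : ℝ) : ℝ :=
  (complexGaussian P.Re).real {z : ℂ | ‖((Real.sqrt (P.cr * x) : ℝ) : ℂ) + z‖ ^ 2 ≤ y}

/-- `V_γ(x, r)`, the expected net reward of a second-level probing when `R⁽¹⁾ = x`, the
transmission rate is `r` and a unit of system time costs `γ`. -/
def Params.V (P : Params) (γ x r : ℝ) : ℝ :=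
  (1 - P.τ) * (r - γ) * (1 - P.G r x) - γ * P.τ

open Classical in
/-- The expected net reward of each feedback when `R⁽¹⁾ = x`. -/
def Params.reward (P : Params) (γ r x : ℝ) : Feedback → ℝ
  | .nack => 0
  | .ack => (if r ≤ x then r else 0) - γ
  | .erasure => P.V γ x r

open Classical in
/-- First-level rule of Strategy A with lower threshold `xv` and transmission rate `r`. -/
def feedbackA (xv r x : ℝ) : Feedback :=
  if r ≤ x then .ack else if x < xv then .nack else .erasure

open Classical in
/-- First-level rule of Strategy B with threshold and transmission rate `r`. -/
def feedbackB (r x : ℝ) : Feedback := if r ≤ x then .ack else .nack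

lemma measurable_feedbackA (xv r : ℝ) : Measurable (feedbackA xv r) :=
  Measurable.ite measurableSet_Ici measurable_const
    (Measurable.ite measurableSet_Iio measurable_const measurable_const)

lemma measurable_feedbackB (r : ℝ) : Measurable (feedbackB r) :=
  Measurable.ite measurableSet_Ici measurable_const measurable_const

lemma measurable_decide_le (r : ℝ) : Measurable (fun y : ℝ => decide (r ≤ y)) := by
  have h : Measurable (fun y : ℝ => if y ∈ Set.Ici r then true else false) :=
    Measurable.ite measurableSet_Ici measurable_const measurable_const
  have he : (fun y : ℝ => decide (r ≤ y)) =
      fun y : ℝ => if y ∈ Set.Ici r then true else false := by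
    funext y
    by_cases hy : r ≤ y <;> simp [hy]
  rw [he]
  exact h

/-- Strategy A: "1" if `R⁽¹⁾ ≥ r`, "0" if `R⁽¹⁾ < xv`, and otherwise "e", followed by
"1" iff `R⁽²⁾ ≥ r`. -/
def policyA (xv r : ℝ) : Policy where
  first _ o := feedbackA xv r o.2.2
  second _ o := decide (r ≤ o.2.2.2)
  measurable_first _ := (measurable_feedbackA xv r).comp (by fun_prop)
  measurable_second _ := (measurable_decide_le r).comp (by fun_prop)

/-- Strategy B: "1" if `R⁽¹⁾ ≥ r` and "0" otherwise; "e" is never fed back. -/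
def policyB (r : ℝ) : Policy where
  first _ o := feedbackB r o.2.2
  second _ _ := false
  measurable_first _ := (measurable_feedbackB r).comp (by fun_prop)
  measurable_second _ := measurable_const

open Classical in
/-- Strategy A with lower threshold `xv` and transmission rate `r`, where `xv` solves
`V_γ(xv, r) = 0` at `γ = γ*(r)` (`xv = 0` if `V_γ(·, r)` is already nonnegative at `0`), is
optimal: no feedback has a larger expected net reward than the one it selects, and its throughput,
given explicitly in terms of `xv` and `r`, is the largest of all admissible policies at all
transmission rates. -/
def Probing.StrategyAOptimal {P : Params} {Ω : Type*} [MeasurableSpace Ω] {μ : Measure Ω}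
    (M : Probing P μ) (xv r : ℝ) : Prop :=
  0 ≤ xv ∧ xv ≤ r ∧
  (∀ x, 0 ≤ x → (0 ≤ P.V (M.gammaStar r) x r ↔ xv ≤ x)) ∧
  (P.V (M.gammaStar r) xv r = 0 ∨ (xv = 0 ∧ 0 < P.V (M.gammaStar r) 0 r)) ∧
  (∀ x, 0 ≤ x → ∀ u, P.reward (M.gammaStar r) r x u ≤
    P.reward (M.gammaStar r) r x (feedbackA xv r x)) ∧
  M.Admissible (policyA xv r) ∧
  M.throughput (policyA xv r) r = M.gammaStar r ∧
  IsGreatest M.achievableAll (M.gammaStar r) ∧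
  let I := ∫ u in Set.Ico xv r, (1 - P.G r u) ∂(μ.map (M.R1 0))
  M.gammaStar r =
    ((1 - P.τ) * r * I + r * Real.exp (-r / M.meanR1)) /
      ((1 - P.τ) * (I + Real.exp (-r / M.meanR1)) +
        P.τ * (1 / (P.ps : ℝ) + Real.exp (-xv / M.meanR1)))

/-- Strategy B with threshold and transmission rate `r` is optimal: at every value of `R⁽¹⁾`
a second-level probing has a smaller expected net reward than the better one of "0" and "1", which
the strategy selects, and its throughput is the optimal one-level throughput at `r` and the
largest of all admissible policies at all transmission rates. -/
def Probing.StrategyBOptimal {P : Params} {Ω : Type*} [MeasurableSpace Ω] {μ : Measure Ω}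
    (M : Probing P μ) (r : ℝ) : Prop :=
  (∀ x, 0 ≤ x → P.V (M.gammaHat r) x r < P.reward (M.gammaHat r) r x (feedbackB r x)) ∧
  (∀ x, 0 ≤ x → ∀ u, P.reward (M.gammaHat r) r x u ≤
    P.reward (M.gammaHat r) r x (feedbackB r x)) ∧
  M.Admissible (policyB r) ∧
  M.throughput (policyB r) r = M.gammaHat r ∧
  IsGreatest M.achievableAll (M.gammaHat r)

/-- `r` solves `(r / E[R⁽¹⁾] - 1) exp (r / E[R⁽¹⁾]) = p_s / τ`. -/
def Probing.IsHatRate {P : Params} {Ω : Type*} [MeasurableSpace Ω] {μ : Measure Ω}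
    (M : Probing P μ) (r : ℝ) : Prop :=
  0 < r ∧ (r / M.meanR1 - 1) * Real.exp (r / M.meanR1) = (P.ps : ℝ) / P.τ

end DOS

end

/-! Put a price `γ` on each unit of time. Rounds are i.i.d., so, given any past, a reached round
earns at most `netReward γ r` on average: the mean of the best of the three rewards, minus the price
`γ τ / p_s` of contention. In `γ ≥ 0` this is continuous and strictly decreasing, positive at `0`
and negative at `r`, hence it vanishes at a single point of `(0, r)`. At that price the expected
data of every reached round are at most `γ` times its expected time. Summing over rounds bounds
every throughput by `γ`, and a policy that always picks the best feedback attains it. So `γ*(r)` is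
the zero of `netReward · r` (`throughput_le`, `isGreatest_achievable`).

The form of the best feedback comes from one monotonicity: the Gaussian mass of a disk drops as its
centre leaves the origin (`complexGaussian_disk_lt`), so `V_γ(x, r)` is strictly increasing in `x`.
Moreover `V < r - γ`, so "1" beats "e" once `x ≥ r`. If `V ≥ 0` at `x = r`, the sign change of `V`
gives the lower threshold of Strategy A. If `V < 0` there, probing is never worthwhile and the
one-level rule is best at this rate. Then `γ* = γ̂` at the maximizing rate, and as `γ̂` has `Rhat`
as its only maximizer (`oneRate_lt_oneRate`), the rate is `Rhat`.

A maximizing rate exists because `γ*` is continuous, `γ*(r) < r` handles small rates, and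
integrability of the two rates makes any positive price unprofitable for large `r`
(`eventually_netReward_neg`). -/

noncomputable section

namespace DOS

/-! ### The circular complex Gaussian law -/

/-- The density of `CN(0, v)`. -/
def complexGaussianDensity (v : ℝ) (z : ℂ) : ℝ := (Real.pi * v)⁻¹ * Real.exp (-‖z‖ ^ 2 / v)

lemma continuous_complexGaussianDensity (v : ℝ) : Continuous (complexGaussianDensity v) := by
  unfold complexGaussianDensity; fun_prop

lemma complexGaussianDensity_pos {v : ℝ} (hv : 0 < v) (z : ℂ) : 0 < complexGaussianDensity v z := by
  unfold complexGaussianDensity; positivity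

lemma complexGaussianDensity_lt {v : ℝ} (hv : 0 < v) {z z' : ℂ} (h : ‖z‖ < ‖z'‖) :
    complexGaussianDensity v z' < complexGaussianDensity v z := by
  unfold complexGaussianDensity
  gcongr

lemma gaussianPDFReal_mul_gaussianPDFReal {v : ℝ} (hv : 0 < v) (z : ℂ) :
    gaussianPDFReal 0 (v / 2).toNNReal z.re * gaussianPDFReal 0 (v / 2).toNNReal z.im =
      complexGaussianDensity v z := by
  have h2 : ((v / 2).toNNReal : ℝ) = v / 2 := Real.coe_toNNReal _ (by positivity)
  have h3 : 0 ≤ 2 * Real.pi * (v / 2) := by positivity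
  simp only [gaussianPDFReal, h2, complexGaussianDensity]
  rw [mul_mul_mul_comm, ← mul_inv, Real.mul_self_sqrt h3, ← Real.exp_add, Complex.sq_norm,
    Complex.normSq_apply]
  congr 2
  · ring
  · ring

instance isProbabilityMeasure_complexGaussian (v : ℝ) :
    IsProbabilityMeasure (complexGaussian v) :=
  Measure.isProbabilityMeasure_map (MeasurableEquiv.measurable _).aemeasurable

lemma complexGaussian_eq_withDensity {v : ℝ} (hv : 0 < v) :
    complexGaussian v =
      volume.withDensity (fun z => ENNReal.ofReal (complexGaussianDensity v z)) := by
  have hne : (v / 2).toNNReal ≠ 0 := by simpa using hv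
  have hm : Measurable (fun z : ℂ => ENNReal.ofReal (complexGaussianDensity v z)) :=
    (continuous_complexGaussianDensity v).measurable.ennreal_ofReal
  ext s hs
  rw [complexGaussian, gaussianReal_of_var_ne_zero _ hne,
    prod_withDensity (measurable_gaussianPDF _ _) (measurable_gaussianPDF _ _),
    Measure.map_apply (MeasurableEquiv.measurable _) hs, withDensity_apply _ hs,
    withDensity_apply _ ((MeasurableEquiv.measurable _) hs),
    ← Complex.volume_preserving_equiv_real_prod.symm.setLIntegral_comp_preimage hs hm]
  refine setLIntegral_congr_fun ((MeasurableEquiv.measurable _) hs) fun p _ => ?_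
  have := gaussianPDFReal_mul_gaussianPDFReal hv (Complex.measurableEquivRealProd.symm p)
  simp only [gaussianPDF]
  rw [← ENNReal.ofReal_mul (gaussianPDFReal_nonneg _ _ _), ← this]
  rfl

lemma complexGaussian_absolutelyContinuous {v : ℝ} (hv : 0 < v) :
    complexGaussian v ≪ volume := by
  rw [complexGaussian_eq_withDensity hv]
  exact withDensity_absolutelyContinuous _ _

/-- The exceptional set lies on a circle, which is Lebesgue null. This makes `≤` and `<`
interchangeable for the rates and lies behind the continuity of `G`. -/
lemma ae_norm_add_sq_ne {v : ℝ} (hv : 0 < v) (c : ℂ) (y : ℝ) :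
    ∀ᵐ z ∂complexGaussian v, ‖c + z‖ ^ 2 ≠ y := by
  refine (complexGaussian_absolutelyContinuous hv).ae_le ?_
  have h0 : volume (Metric.sphere (-c) (Real.sqrt y)) = 0 := Measure.addHaar_sphere _ _ _
  refine measure_mono_null (fun z hz => ?_) h0
  simp only [Set.mem_compl_iff, Set.mem_ofPred_eq, not_not] at hz
  simp [← hz, Real.sqrt_sq, add_comm]

/-- Invariance of `CN(0, v)` under linear isometries. -/
lemma measurePreserving_complexGaussian {v : ℝ} (hv : 0 < v) (f : ℂ ≃ₗᵢ[ℝ] ℂ) :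
    MeasurePreserving f (complexGaussian v) (complexGaussian v) := by
  refine ⟨f.continuous.measurable, ?_⟩
  have hm : Measurable (fun z : ℂ => ENNReal.ofReal (complexGaussianDensity v z)) :=
    (continuous_complexGaussianDensity v).measurable.ennreal_ofReal
  ext s hs
  rw [Measure.map_apply f.continuous.measurable hs, complexGaussian_eq_withDensity hv,
    withDensity_apply _ hs, withDensity_apply _ (f.continuous.measurable hs),
    ← f.measurePreserving.setLIntegral_comp_preimage hs hm]
  simp [complexGaussianDensity]

/-- Needed with `c = √b`, to pass from the refinement `CN(0, w)` to the law `CN(0, b w)` used in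
`G`. -/
lemma complexGaussian_map_mul {v c : ℝ} (hv : 0 ≤ v) :
    (complexGaussian v).map (fun z => (c : ℂ) * z) = complexGaussian (c ^ 2 * v) := by
  have h1 : (gaussianReal 0 (v / 2).toNNReal).map (fun x => c * x) =
      gaussianReal 0 (c ^ 2 * v / 2).toNNReal := by
    rw [gaussianReal_map_const_mul, mul_zero]
    congr 1
    ext
    have : 0 ≤ c ^ 2 * v / 2 := by positivity
    have h' : 0 ≤ v / 2 := by positivity
    rw [Real.coe_toNNReal _ this, NNReal.coe_mul, Real.coe_toNNReal _ h']
    simp only [NNReal.coe_mk]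
    ring
  have hm : Measurable (fun x : ℝ => c * x) := by fun_prop
  rw [complexGaussian, complexGaussian, ← h1, Measure.map_prod_map _ _ hm hm,
    Measure.map_map (by fun_prop) (by fun_prop), Measure.map_map (by fun_prop) (by fun_prop)]
  congr 1
  funext p
  apply Complex.ext <;> simp [Complex.measurableEquivRealProd_symm_apply]

/-- The squared modulus of a `CN(0, v)` variable is exponential with mean `v`. -/
lemma complexGaussian_norm_sq_ge {v : ℝ} (hv : 0 < v) {s : ℝ} (hs : 0 ≤ s) :
    complexGaussian v {z | s ≤ ‖z‖ ^ 2} = ENNReal.ofReal (Real.exp (-s / v)) := by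
  have hms : MeasurableSet {z : ℂ | s ≤ ‖z‖ ^ 2} := measurableSet_le (by fun_prop) (by fun_prop)
  rw [complexGaussian_eq_withDensity hv, withDensity_apply _ hms, ← lintegral_indicator hms,
    ← Complex.lintegral_comp_polarCoord_symm, polarCoord_target]
  have e1 : ∀ p ∈ Set.Ioi (0 : ℝ) ×ˢ Set.Ioo (-Real.pi) Real.pi,
      ENNReal.ofReal p.1 • ({z : ℂ | s ≤ ‖z‖ ^ 2}.indicator
        (fun z => ENNReal.ofReal (complexGaussianDensity v z)) (Complex.polarCoord.symm p)) =
      (Set.Ici (Real.sqrt s)).indicator (fun x => ENNReal.ofReal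
        (x * ((Real.pi * v)⁻¹ * Real.exp (-x ^ 2 / v)))) p.1 * (fun _ : ℝ => 1) p.2 := by
    rintro ⟨x, t⟩ ⟨hx, -⟩
    have hx : 0 < x := hx
    have hiff : s ≤ x ^ 2 ↔ Real.sqrt s ≤ x := (Real.sqrt_le_left hx.le).symm
    by_cases h : s ≤ x ^ 2
    · have h' := hiff.1 h
      simp only [Set.indicator, Set.mem_ofPred_eq, Complex.norm_polarCoord_symm, sq_abs, h, h',
        if_true, Set.mem_Ici, complexGaussianDensity, smul_eq_mul, mul_one]
      rw [← ENNReal.ofReal_mul hx.le]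
    · have h' : ¬ Real.sqrt s ≤ x := fun h' => h (hiff.2 h')
      simp [Set.indicator, h, h']
  have hx0 : 0 ≤ Real.sqrt s := Real.sqrt_nonneg s
  -- An antiderivative of the radial part in polar coordinates; its factor `(2π)⁻¹` cancels the
  -- length of the angular interval.
  have hd : ∀ x ∈ Set.Ici (Real.sqrt s), HasDerivAt
      (fun x => -(2 * Real.pi)⁻¹ * Real.exp (-x ^ 2 / v))
      (x * ((Real.pi * v)⁻¹ * Real.exp (-x ^ 2 / v))) x := by
    intro x _
    have h := ((((hasDerivAt_pow 2 x).neg.div_const v).exp).const_mul (-(2 * Real.pi)⁻¹))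
    refine h.congr_deriv ?_
    have := Real.pi_pos
    simp
    field_simp
  have hpos : ∀ x ∈ Set.Ioi (Real.sqrt s),
      0 ≤ x * ((Real.pi * v)⁻¹ * Real.exp (-x ^ 2 / v)) := by
    intro x hx
    have : 0 ≤ x := hx0.trans (le_of_lt hx)
    positivity
  have hlim : Filter.Tendsto (fun x => -(2 * Real.pi)⁻¹ * Real.exp (-x ^ 2 / v))
      Filter.atTop (nhds (-(2 * Real.pi)⁻¹ * 0)) := by
    refine Filter.Tendsto.const_mul _ (Real.tendsto_exp_atBot.comp ?_)
    simp_rw [neg_div]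
    exact Filter.tendsto_neg_atTop_atBot.comp
      ((Filter.tendsto_pow_atTop two_ne_zero).atTop_div_const hv)
  have hint := integrableOn_Ioi_deriv_of_nonneg' hd hpos hlim
  have hval := integral_Ioi_of_hasDerivAt_of_nonneg' hd hpos hlim
  have hset : (volume : Measure ℝ).restrict (Set.Ici (Real.sqrt s) ∩ Set.Ioi 0) =
      volume.restrict (Set.Ioi (Real.sqrt s)) := by
    rcases hx0.eq_or_lt with h | h
    · rw [← h, Set.inter_eq_right.2 Set.Ioi_subset_Ici_self]
    · have : Set.Ici (Real.sqrt s) ⊆ Set.Ioi 0 := fun x hx => h.trans_le hx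
      rw [Set.inter_eq_left.2 this, Measure.restrict_congr_set Ioi_ae_eq_Ici]
  have hind : Measurable ((Set.Ici (Real.sqrt s)).indicator (fun x => ENNReal.ofReal
        (x * ((Real.pi * v)⁻¹ * Real.exp (-x ^ 2 / v))))) :=
    Measurable.indicator (by fun_prop) measurableSet_Ici
  rw [setLIntegral_congr_fun (measurableSet_Ioi.prod measurableSet_Ioo) e1,
    Measure.volume_eq_prod, ← Measure.prod_restrict,
    lintegral_prod_mul (g := fun _ : ℝ => 1) hind.aemeasurable aemeasurable_const,
    setLIntegral_indicator measurableSet_Ici, hset,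
    ← ofReal_integral_eq_lintegral_ofReal hint, hval]
  · simp only [lintegral_const, MeasurableSet.univ, Measure.restrict_apply, Set.univ_inter,
      Real.volume_Ioo, one_mul]
    rw [← ENNReal.ofReal_mul', Real.sq_sqrt hs]
    · congr 1
      have := Real.pi_pos
      field_simp
      ring
    · have := Real.pi_pos
      linarith
  · exact (ae_restrict_iff' measurableSet_Ioi).2 (Filter.Eventually.of_forall hpos)

lemma memLp_re_complexGaussian (v : ℝ) : MemLp Complex.re 2 (complexGaussian v) := by
  rw [complexGaussian]
  refine (memLp_map_measure_iff (by fun_prop) (by fun_prop)).2 ?_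
  exact (memLp_id_gaussianReal 2).comp_measurePreserving measurePreserving_fst

lemma memLp_im_complexGaussian (v : ℝ) : MemLp Complex.im 2 (complexGaussian v) := by
  rw [complexGaussian]
  refine (memLp_map_measure_iff (by fun_prop) (by fun_prop)).2 ?_
  exact (memLp_id_gaussianReal 2).comp_measurePreserving measurePreserving_snd

lemma integrable_norm_sq_complexGaussian (v : ℝ) :
    Integrable (fun z => ‖z‖ ^ 2) (complexGaussian v) := by
  refine ((memLp_re_complexGaussian v).integrable_sq.add
    (memLp_im_complexGaussian v).integrable_sq).congr (Filter.Eventually.of_forall fun z => ?_)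
  simp only [Complex.sq_norm, Complex.normSq_apply, Pi.add_apply]
  ring

lemma integral_sq_gaussianReal (v : NNReal) : ∫ x, x ^ 2 ∂gaussianReal 0 v = v := by
  have h := variance_of_integral_eq_zero (X := fun x : ℝ => x) (μ := gaussianReal 0 v)
    (by fun_prop) (by simp)
  rw [variance_fun_id_gaussianReal] at h
  exact h.symm

lemma integral_norm_sq_complexGaussian {v : ℝ} (hv : 0 ≤ v) :
    ∫ z, ‖z‖ ^ 2 ∂complexGaussian v = v := by
  have e : (fun z : ℂ => ‖z‖ ^ 2) = fun z => z.re ^ 2 + z.im ^ 2 := by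
    funext z
    simp only [Complex.sq_norm, Complex.normSq_apply]
    ring
  have hg : ∫ x, x ^ 2 ∂gaussianReal 0 (v / 2).toNNReal = v / 2 := by
    rw [integral_sq_gaussianReal, Real.coe_toNNReal _ (by positivity)]
  have hre : ∫ z, z.re ^ 2 ∂complexGaussian v = v / 2 := by
    rw [complexGaussian, integral_map_equiv]
    have := integral_fun_fst (μ := gaussianReal 0 (v / 2).toNNReal)
      (ν := gaussianReal 0 (v / 2).toNNReal) (fun x => x ^ 2)
    simpa [hg] using this
  have him : ∫ z, z.im ^ 2 ∂complexGaussian v = v / 2 := by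
    rw [complexGaussian, integral_map_equiv]
    have := integral_fun_snd (μ := gaussianReal 0 (v / 2).toNNReal)
      (ν := gaussianReal 0 (v / 2).toNNReal) (fun x => x ^ 2)
    simpa [hg] using this
  rw [e, integral_add (memLp_re_complexGaussian v).integrable_sq
    (memLp_im_complexGaussian v).integrable_sq, hre, him]
  ring

/-- The mass of a disk decreases strictly when its centre moves away from the origin. -/
lemma complexGaussian_disk_lt {v : ℝ} (hv : 0 < v) {c c' y : ℝ} (hc : 0 ≤ c) (hcc : c < c')
    (hy : 0 < y) :
    (complexGaussian v).real {z : ℂ | ‖(c' : ℂ) + z‖ ^ 2 ≤ y} <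
      (complexGaussian v).real {z : ℂ | ‖(c : ℂ) + z‖ ^ 2 ≤ y} := by
  set A : Set ℂ := {z : ℂ | ‖(c : ℂ) + z‖ ^ 2 ≤ y} with hA
  set B : Set ℂ := {z : ℂ | ‖(c' : ℂ) + z‖ ^ 2 ≤ y} with hB
  have hAm : MeasurableSet A := measurableSet_le (by fun_prop) (by fun_prop)
  have hBm : MeasurableSet B := measurableSet_le (by fun_prop) (by fun_prop)
  -- Reflection in the line `Re z = -(c + c') / 2`, which exchanges the disks `A` and `B`, centred
  -- at `-c` and `-c'`.
  let f : ℂ → ℂ := fun z => -(((c + c' : ℝ) : ℂ) + Complex.conjLIE z)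
  have hf : MeasurePreserving f volume volume :=
    (Measure.measurePreserving_neg volume).comp
      ((measurePreserving_add_left volume ((c + c' : ℝ) : ℂ)).comp
        Complex.conjLIE.measurePreserving)
  have hn : ∀ (t : ℝ) (z : ℂ), ‖(t : ℂ) + z‖ ^ 2 = (t + z.re) ^ 2 + z.im ^ 2 := by
    intro t z
    simp only [Complex.sq_norm, Complex.normSq_apply, Complex.add_re, Complex.add_im,
      Complex.ofReal_re, Complex.ofReal_im]
    ring
  have hn0 : ∀ z : ℂ, ‖z‖ ^ 2 = z.re ^ 2 + z.im ^ 2 := by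
    intro z
    simp only [Complex.sq_norm, Complex.normSq_apply]
    ring
  have hfre : ∀ z, (f z).re = -(c + c') - z.re := by
    intro z; simp [f]; ring
  have hfim : ∀ z, (f z).im = z.im := by
    intro z; simp [f]
  have hpre : f ⁻¹' (B \ A) = A \ B := by
    ext z
    simp only [hA, hB, Set.mem_preimage, Set.mem_sdiff, Set.mem_ofPred_eq, hn, hfre, hfim]
    have e1 : (c' + (-(c + c') - z.re)) ^ 2 = (c + z.re) ^ 2 := by ring
    have e2 : (c + (-(c + c') - z.re)) ^ 2 = (c' + z.re) ^ 2 := by ring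
    rw [e1, e2]
  -- A point of `A \ B` is nearer to `-c` than to `-c'`, so it lies on the origin's side of the
  -- mirror line; reflecting it increases its modulus, by `‖f z‖² - ‖z‖² = (c + c')(c + c' + 2 Re
  -- z)`.
  have hlt : ∀ z ∈ A \ B, complexGaussianDensity v (f z) < complexGaussianDensity v z := by
    intro z hz
    refine complexGaussianDensity_lt hv ?_
    simp only [hA, hB, Set.mem_sdiff, Set.mem_ofPred_eq, hn, not_le] at hz
    have h1 : (c' - c) * 0 < (c' - c) * (c + c' + 2 * z.re) := by nlinarith
    have h2 : 0 < c + c' + 2 * z.re := lt_of_mul_lt_mul_left h1 (by linarith)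
    refine lt_of_pow_lt_pow_left₀ 2 (norm_nonneg _) ?_
    rw [hn0, hn0, hfre, hfim]
    nlinarith
  have hcont := continuous_complexGaussianDensity v
  have hm : Measurable (fun z : ℂ => ENNReal.ofReal (complexGaussianDensity v z)) :=
    hcont.measurable.ennreal_ofReal
  have hpos : 0 < volume (A \ B) := by
    have ho : IsOpen {z : ℂ | ‖(c : ℂ) + z‖ ^ 2 < y ∧ y < ‖(c' : ℂ) + z‖ ^ 2} :=
      (isOpen_lt (f := fun z : ℂ => ‖(c : ℂ) + z‖ ^ 2) (by fun_prop) continuous_const).and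
        (isOpen_lt continuous_const (by fun_prop))
    refine (ho.measure_pos volume ?_).trans_le
      (measure_mono fun z hz => ⟨hz.1.le, fun h => (lt_irrefl _ (hz.2.trans_le h))⟩)
    -- The real point `t - c` is at distance `t < √y` from the centre of `A` and `t + (c' - c) > √y`
    -- from that of `B`.
    obtain ⟨t, ht1, ht2⟩ := exists_between (show max 0 (Real.sqrt y - (c' - c)) < Real.sqrt y from
      max_lt (Real.sqrt_pos.2 hy) (by linarith))
    have ht0 : 0 < t := (le_max_left _ _).trans_lt ht1
    have ht3 : Real.sqrt y < t + (c' - c) := by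
      have := (le_max_right _ _).trans_lt ht1
      linarith
    refine ⟨((t - c : ℝ) : ℂ), ?_, ?_⟩
    · rw [hn]
      simp only [Complex.ofReal_re, Complex.ofReal_im]
      have := (Real.lt_sqrt ht0.le).1 ht2
      nlinarith
    · rw [hn]
      simp only [Complex.ofReal_re, Complex.ofReal_im]
      have := (Real.sqrt_lt' (by linarith)).1 ht3
      nlinarith
  -- The reflection turns both masses into integrals over `A \ B`, where the densities compare
  -- strictly; the common part `A ∩ B` is added back at the end.
  have hdiff : complexGaussian v (B \ A) < complexGaussian v (A \ B) := by
    rw [complexGaussian_eq_withDensity hv, withDensity_apply _ (hBm.diff hAm),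
      withDensity_apply _ (hAm.diff hBm), ← hf.setLIntegral_comp_preimage (hBm.diff hAm) hm, hpre]
    refine setLIntegral_strict_mono (hAm.diff hBm) hpos.ne' hm ?_ ?_
    · rw [← hpre, hf.setLIntegral_comp_preimage (hBm.diff hAm) hm,
        ← withDensity_apply _ (hBm.diff hAm), ← complexGaussian_eq_withDensity hv]
      exact measure_ne_top _ _
    · exact Filter.Eventually.of_forall fun z hz =>
        (ENNReal.ofReal_lt_ofReal_iff (complexGaussianDensity_pos hv _)).2 (hlt z hz)
  rw [measureReal_def, measureReal_def]
  refine (ENNReal.toReal_lt_toReal (measure_ne_top _ _) (measure_ne_top _ _)).2 ?_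
  rw [← measure_inter_add_sdiff B hAm, ← measure_inter_add_sdiff A hBm, Set.inter_comm]
  exact ENNReal.add_lt_add_left (measure_ne_top _ _) hdiff

/-! ### The conditional distribution function `G` -/

namespace Params
variable (P : Params)

lemma cr_pos : 0 < P.cr := div_pos P.b_pos P.a_pos

lemma Re_pos : 0 < P.Re := mul_pos P.b_pos P.w_pos

lemma G_nonneg (y x : ℝ) : 0 ≤ P.G y x := measureReal_nonneg

lemma G_le_one (y x : ℝ) : P.G y x ≤ 1 := measureReal_le_one

lemma G_strictAnti {y x x' : ℝ} (hy : 0 < y) (hx : 0 ≤ x) (hxx : x < x') :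
    P.G y x' < P.G y x :=
  complexGaussian_disk_lt P.Re_pos (Real.sqrt_nonneg _)
    (Real.sqrt_lt_sqrt (mul_nonneg P.cr_pos.le hx) (mul_lt_mul_of_pos_left hxx P.cr_pos)) hy

/-- As the parameters vary, the indicators of the disks converge at every point off the limiting
circle, hence almost everywhere. -/
lemma continuous_G : Continuous (fun p : ℝ × ℝ => P.G p.1 p.2) := by
  have hmeas : ∀ p : ℝ × ℝ,
      MeasurableSet {z : ℂ | ‖((Real.sqrt (P.cr * p.2) : ℝ) : ℂ) + z‖ ^ 2 ≤ p.1} :=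
    fun p => measurableSet_le (by fun_prop) (by fun_prop)
  rw [continuous_iff_continuousAt]
  intro p
  have h := tendsto_measure_of_ae_tendsto_indicator_of_isFiniteMeasure
    (μ := complexGaussian P.Re) (nhds p)
    (A := {z : ℂ | ‖((Real.sqrt (P.cr * p.2) : ℝ) : ℂ) + z‖ ^ 2 ≤ p.1})
    (As := fun q : ℝ × ℝ => {z : ℂ | ‖((Real.sqrt (P.cr * q.2) : ℝ) : ℂ) + z‖ ^ 2 ≤ q.1})
    (hmeas p) hmeas ?_
  · exact (ENNReal.tendsto_toReal (measure_ne_top _ _)).comp h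
  · filter_upwards [ae_norm_add_sq_ne P.Re_pos ((Real.sqrt (P.cr * p.2) : ℝ) : ℂ) p.1] with z hz
    have hc : Continuous fun q : ℝ × ℝ => ‖((Real.sqrt (P.cr * q.2) : ℝ) : ℂ) + z‖ ^ 2 := by
      fun_prop
    rcases lt_or_gt_of_ne hz with hz | hz
    · filter_upwards [hc.continuousAt.eventually_lt continuous_fst.continuousAt hz] with q hq
      simp [hq.le, hz.le]
    · filter_upwards [continuous_fst.continuousAt.eventually_lt hc.continuousAt hz] with q hq
      simp [not_le.2 hq, not_le.2 hz]

/-- `G(y | R⁽¹⁾)` is the conditional distribution function of `R⁽²⁾` given the first-level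
channel estimate. -/
lemma G_eq (y : ℝ) (h : ℂ) :
    P.G y (P.a * ‖h‖ ^ 2) = (complexGaussian P.w).real {e | P.b * ‖h + e‖ ^ 2 ≤ y} := by
  -- The law of `e` is rotation invariant, so the phase `u` of `h` can be absorbed into `e` and only
  -- `‖h‖` matters.
  obtain ⟨u, hu⟩ : ∃ u : Circle, h = (u : ℂ) * (‖h‖ : ℂ) := by
    refine ⟨Circle.exp h.arg, ?_⟩
    rw [mul_comm, Circle.coe_exp]
    exact (Complex.norm_mul_exp_arg_mul_I h).symm
  have hb : (Real.sqrt P.b) ^ 2 = P.b := Real.sq_sqrt P.b_pos.le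
  have hsq : Real.sqrt (P.cr * (P.a * ‖h‖ ^ 2)) = Real.sqrt P.b * ‖h‖ := by
    have ha := P.a_pos.ne'
    rw [Params.cr, show P.b / P.a * (P.a * ‖h‖ ^ 2) = P.b * ‖h‖ ^ 2 by field_simp,
      Real.sqrt_mul P.b_pos.le, Real.sqrt_sq (norm_nonneg _)]
  have hm : Measurable (fun z : ℂ => ((Real.sqrt P.b : ℝ) : ℂ) * z) := by fun_prop
  rw [Params.G, hsq, Params.Re, ← hb, ← complexGaussian_map_mul P.w_pos.le, hb,
    measureReal_def, measureReal_def, Measure.map_apply hm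
      (measurableSet_le (by fun_prop) (by fun_prop)),
    ← (measurePreserving_complexGaussian P.w_pos (rotation u)).measure_preimage
      (measurableSet_le (by fun_prop) (by fun_prop)).nullMeasurableSet]
  congr 2
  ext e
  simp only [Set.mem_preimage, Set.mem_ofPred_eq, rotation_apply]
  have e1 : ((Real.sqrt P.b * ‖h‖ : ℝ) : ℂ) + ((Real.sqrt P.b : ℝ) : ℂ) * e =
      ((Real.sqrt P.b : ℝ) : ℂ) * ((‖h‖ : ℂ) + e) := by push_cast; ring
  have e2 : h + (u : ℂ) * e = (u : ℂ) * ((‖h‖ : ℂ) + e) := by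
    nth_rw 1 [hu]; ring
  rw [e1, e2, norm_mul, norm_mul, mul_pow, Circle.norm_coe, one_mul, Complex.norm_real,
    Real.norm_eq_abs, sq_abs, hb]

/-- Reception requires `R⁽²⁾ ≥ y`, while `1 - G` is the probability of `R⁽²⁾ > y`; the boundary
circle has mass zero. -/
lemma one_sub_G_eq (y : ℝ) (h : ℂ) :
    (complexGaussian P.w).real {e | y ≤ P.b * ‖h + e‖ ^ 2} = 1 - P.G y (P.a * ‖h‖ ^ 2) := by
  have hm : MeasurableSet {e : ℂ | P.b * ‖h + e‖ ^ 2 ≤ y} :=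
    measurableSet_le (by fun_prop) (by fun_prop)
  rw [G_eq, ← probReal_compl_eq_one_sub hm]
  refine measureReal_congr ?_
  filter_upwards [ae_norm_add_sq_ne P.w_pos h (y / P.b)] with e he
  have hne : P.b * ‖h + e‖ ^ 2 ≠ y := by
    intro h'
    apply he
    rw [← h']
    have := P.b_pos.ne'
    field_simp
  apply propext
  change y ≤ P.b * ‖h + e‖ ^ 2 ↔ ¬ (P.b * ‖h + e‖ ^ 2 ≤ y)
  rw [not_le]
  exact ⟨fun h' => lt_of_le_of_ne h' hne.symm, le_of_lt⟩

end Params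

/-! ### Law of the first-level rate, and net rewards at a given price of time -/

namespace Params
variable (P : Params)

/-- The law of the first-level rate `R⁽¹⁾`. -/
def rateLaw : Measure ℝ := (complexGaussian P.v).map (fun z => P.a * ‖z‖ ^ 2)

/-- The mean of the first-level rate `R⁽¹⁾`. -/
def mean : ℝ := P.a * P.v

lemma mean_pos : 0 < P.mean := mul_pos P.a_pos P.v_pos

lemma ps_real_pos : 0 < (P.ps : ℝ) := P.ps_pos

instance : IsProbabilityMeasure P.rateLaw :=
  Measure.isProbabilityMeasure_map (by fun_prop)

lemma rateLaw_Ici {x : ℝ} (hx : 0 ≤ x) :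
    P.rateLaw.real (Set.Ici x) = Real.exp (-x / P.mean) := by
  have ha := P.a_pos
  rw [measureReal_def, rateLaw, Measure.map_apply (by fun_prop) measurableSet_Ici]
  have : (fun z : ℂ => P.a * ‖z‖ ^ 2) ⁻¹' Set.Ici x = {z | x / P.a ≤ ‖z‖ ^ 2} := by
    ext z
    simp [div_le_iff₀ ha, mul_comm]
  rw [this, complexGaussian_norm_sq_ge P.v_pos (by positivity),
    ENNReal.toReal_ofReal (Real.exp_pos _).le, mean]
  congr 1
  field_simp

lemma ae_rateLaw_nonneg : ∀ᵐ x ∂P.rateLaw, 0 ≤ x := by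
  have ha := P.a_pos
  refine (ae_map_iff (by fun_prop) measurableSet_Ici).2 (Filter.Eventually.of_forall fun z => ?_)
  positivity

lemma ae_rateLaw_ne (y : ℝ) : ∀ᵐ x ∂P.rateLaw, x ≠ y := by
  have ha := P.a_pos
  refine (ae_map_iff (by fun_prop) (measurableSet_singleton y).compl).2 ?_
  filter_upwards [ae_norm_add_sq_ne P.v_pos 0 (y / P.a)] with z hz h
  apply hz
  rw [zero_add, ← h]
  field_simp

lemma measurable_G (r : ℝ) : Measurable (P.G r) :=
  (P.continuous_G.comp (continuous_const.prodMk continuous_id)).measurable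

lemma continuous_V : Continuous (fun p : ℝ × ℝ × ℝ => P.V p.1 p.2.1 p.2.2) := by
  have : Continuous fun p : ℝ × ℝ × ℝ => P.G p.2.2 p.2.1 := by
    have h := P.continuous_G.comp (f := fun p : ℝ × ℝ × ℝ => (p.2.2, p.2.1)) (by fun_prop)
    simpa only [Function.comp_def] using h
  unfold V
  exact ((continuous_const.mul (continuous_snd.snd.sub continuous_fst)).mul
    (continuous_const.sub this)).sub (continuous_fst.mul continuous_const)

/-- A better first-level rate makes second-level success strictly likelier. All thresholds come from
this. -/
lemma V_strictMonoOn {γ r : ℝ} (hr : 0 < r) (hγ : γ < r) :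
    StrictMonoOn (fun x => P.V γ x r) (Set.Ici 0) := by
  intro x hx x' _ hxx
  have h := P.G_strictAnti hr hx hxx
  have hτ := P.τ_lt_one
  have : 0 < (1 - P.τ) * (r - γ) := mul_pos (by linarith) (by linarith)
  simp only [V]
  nlinarith

lemma V_antitone (x r : ℝ) : Antitone (fun γ => P.V γ x r) := by
  intro γ γ' h
  have hτ := P.τ_lt_one
  have hτ0 := P.τ_pos
  have hG := P.G_le_one r x
  have h1 : 0 ≤ (1 - P.τ) * (1 - P.G r x) := mul_nonneg (by linarith) (by linarith)
  simp only [V]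
  nlinarith

lemma V_le {γ r : ℝ} (hγ : 0 ≤ γ) (hγr : γ ≤ r) (x : ℝ) :
    P.V γ x r ≤ (r - γ) * (1 - P.G r x) := by
  have hτ := P.τ_lt_one
  have hτ0 := P.τ_pos
  have hG := P.G_le_one r x
  have h1 : 0 ≤ P.τ * ((r - γ) * (1 - P.G r x)) :=
    mul_nonneg hτ0.le (mul_nonneg (by linarith) (by linarith))
  simp only [V]
  nlinarith [mul_nonneg hγ hτ0.le]

/-- Even if it surely succeeds, probing shortens the transmission and costs `γ τ`; hence "1" beats
"e" as soon as `x ≥ r`. -/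
lemma V_lt {γ r : ℝ} (hγ : 0 < γ) (hγr : γ ≤ r) (x : ℝ) : P.V γ x r < r - γ := by
  have hτ := P.τ_lt_one
  have hτ0 := P.τ_pos
  have hG := P.G_nonneg r x
  have h1 : 0 ≤ (1 - P.τ) * (r - γ) := mul_nonneg (by linarith) (by linarith)
  have h2 : 0 ≤ P.τ * (r - γ) := mul_nonneg (by linarith) (by linarith)
  simp only [V]
  nlinarith [mul_pos hγ hτ0, mul_nonneg h1 hG]

open Classical in
/-- The largest expected net reward when `R⁽¹⁾ = x`. -/
def bestReward (γ r x : ℝ) : ℝ := max (max 0 ((if r ≤ x then r else 0) - γ)) (P.V γ x r)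

lemma reward_le_bestReward (γ r x : ℝ) (u : Feedback) : P.reward γ r x u ≤ P.bestReward γ r x := by
  cases u
  · exact (le_max_left _ _).trans (le_max_left _ _)
  · exact (le_max_right _ _).trans (le_max_left _ _)
  · exact le_max_right _ _

lemma bestReward_nonneg (γ r x : ℝ) : 0 ≤ P.bestReward γ r x :=
  (le_max_left _ _).trans (le_max_left _ _)

lemma bestReward_antitone (r x : ℝ) : Antitone (fun γ => P.bestReward γ r x) := by
  intro γ γ' h
  exact max_le_max (max_le_max le_rfl (by linarith)) (P.V_antitone x r h)

lemma bestReward_le {γ r : ℝ} (hγ : 0 ≤ γ) (hr : 0 ≤ r) (x : ℝ) : P.bestReward γ r x ≤ r := by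
  refine (P.bestReward_antitone r x hγ).trans (max_le (max_le hr ?_) ?_)
  · split_ifs <;> simp [hr]
  · refine (P.V_le le_rfl hr x).trans ?_
    nlinarith [P.G_nonneg r x]

lemma measurable_bestReward (γ r : ℝ) : Measurable (P.bestReward γ r) := by
  have hV : Measurable fun x => P.V γ x r :=
    (P.continuous_V.comp
      (by fun_prop : Continuous fun x : ℝ => ((γ, x, r) : ℝ × ℝ × ℝ))).measurable
  have hi : Measurable fun x : ℝ => if r ≤ x then r else 0 :=
    Measurable.ite measurableSet_Ici measurable_const measurable_const
  unfold bestReward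
  exact (measurable_const.max (by convert hi.sub_const γ)).max hV

lemma integrable_bestReward {γ r : ℝ} (hγ : 0 ≤ γ) (hr : 0 ≤ r) :
    Integrable (P.bestReward γ r) P.rateLaw :=
  Integrable.of_bound (P.measurable_bestReward γ r).aestronglyMeasurable r
    (Filter.Eventually.of_forall fun x => by
      rw [Real.norm_of_nonneg (P.bestReward_nonneg γ r x)]
      exact P.bestReward_le hγ hr x)

/-- The expected net reward of a round under the best feedback. -/
def netReward (γ r : ℝ) : ℝ := ∫ x, P.bestReward γ r x ∂P.rateLaw - γ * (P.τ / P.ps)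

/-- The best reward is only weakly decreasing in the price; strictness comes from the contention
term. -/
lemma netReward_strictAntiOn {r : ℝ} (hr : 0 ≤ r) :
    StrictAntiOn (fun γ => P.netReward γ r) (Set.Ici 0) := by
  intro γ hγ γ' hγ' h
  have h1 : ∫ x, P.bestReward γ' r x ∂P.rateLaw ≤ ∫ x, P.bestReward γ r x ∂P.rateLaw :=
    integral_mono (P.integrable_bestReward hγ' hr) (P.integrable_bestReward hγ hr)
      fun x => P.bestReward_antitone r x h.le
  have h2 : 0 < P.τ / P.ps := div_pos P.τ_pos P.ps_real_pos
  simp only [netReward]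
  nlinarith

lemma netReward_zero_pos {r : ℝ} (hr : 0 < r) : 0 < P.netReward 0 r := by
  have h1 : ∫ x, (Set.Ici r).indicator (fun _ => r) x ∂P.rateLaw ≤
      ∫ x, P.bestReward 0 r x ∂P.rateLaw := by
    refine integral_mono ((integrable_const r).indicator measurableSet_Ici)
      (P.integrable_bestReward le_rfl hr.le) fun x => ?_
    by_cases hx : r ≤ x
    · have : P.reward 0 r x .ack ≤ _ := P.reward_le_bestReward 0 r x .ack
      simpa [Set.indicator, hx, reward] using this
    · simpa [Set.indicator, hx] using P.bestReward_nonneg 0 r x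
  rw [integral_indicator_const _ measurableSet_Ici, P.rateLaw_Ici hr.le] at h1
  have : 0 < Real.exp (-r / P.mean) • r := by positivity
  simp only [netReward]
  linarith

/-- At price `r` no feedback earns a positive reward, and contention must still be paid for. -/
lemma netReward_self_neg {r : ℝ} (hr : 0 < r) : P.netReward r r < 0 := by
  have h : ∀ x, P.bestReward r r x = 0 := by
    intro x
    refine le_antisymm (max_le (max_le le_rfl ?_) ?_) (P.bestReward_nonneg r r x)
    · split_ifs <;> simp [hr.le]
    · have := mul_pos hr P.τ_pos
      simp [V, this.le]
  have : 0 < r * (P.τ / P.ps) := mul_pos hr (div_pos P.τ_pos P.ps_real_pos)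
  simp only [netReward, h, integral_zero]
  linarith

lemma continuousOn_netReward {r : ℝ} (hr : 0 ≤ r) :
    ContinuousOn (fun γ => P.netReward γ r) (Set.Ici 0) := by
  unfold netReward
  refine ContinuousOn.sub ?_ (by fun_prop)
  refine continuousOn_of_dominated (bound := fun _ => r)
    (fun γ _ => (P.measurable_bestReward γ r).aestronglyMeasurable)
    (fun γ hγ => Filter.Eventually.of_forall fun x => ?_) (integrable_const r)
    (Filter.Eventually.of_forall fun x => Continuous.continuousOn ?_)
  · rw [Real.norm_of_nonneg (P.bestReward_nonneg γ r x)]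
    exact P.bestReward_le hγ hr x
  · have : Continuous fun γ => P.V γ x r :=
      P.continuous_V.comp (by fun_prop : Continuous fun γ : ℝ => ((γ, x, r) : ℝ × ℝ × ℝ))
    unfold bestReward
    fun_prop

/-- For fixed `x` the reward of "1" jumps only at the rate `x`, and `R⁽¹⁾` has no atoms, so
dominated convergence applies. -/
lemma continuousAt_netReward {γ r : ℝ} (hγ : 0 ≤ γ) (hr : 0 < r) :
    ContinuousAt (fun r => P.netReward γ r) r := by
  unfold netReward
  refine ContinuousAt.sub ?_ continuousAt_const
  refine continuousAt_of_dominated (bound := fun _ => r + 1)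
    (Filter.Eventually.of_forall fun r => (P.measurable_bestReward γ r).aestronglyMeasurable)
    ?_ (integrable_const _) ?_
  · filter_upwards [Ioo_mem_nhds hr (lt_add_one r)] with r' hr'
    refine Filter.Eventually.of_forall fun x => ?_
    rw [Real.norm_of_nonneg (P.bestReward_nonneg γ r' x)]
    exact (P.bestReward_le hγ hr'.1.le x).trans hr'.2.le
  · filter_upwards [P.ae_rateLaw_ne r] with x hx
    have hV : Continuous fun r => P.V γ x r :=
      P.continuous_V.comp (by fun_prop : Continuous fun r : ℝ => ((γ, x, r) : ℝ × ℝ × ℝ))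
    have hi : ContinuousAt (fun r' : ℝ => (if r' ≤ x then r' else 0)) r := by
      rcases lt_or_gt_of_ne hx with h | h
      · refine (continuousAt_const (y := (0 : ℝ))).congr ?_
        filter_upwards [Ioi_mem_nhds h] with r' hr'
        simp [not_le.2 (Set.mem_Ioi.1 hr')]
      · refine continuousAt_id.congr ?_
        filter_upwards [Iio_mem_nhds h] with r' hr'
        simp [(Set.mem_Iio.1 hr').le]
    have hi' : ContinuousAt (fun r' : ℝ => (if r' ≤ x then r' else 0) - γ) r :=
      hi.sub continuousAt_const
    unfold bestReward
    have : ContinuousAt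
        (fun r' => max (max 0 ((if r' ≤ x then r' else 0) - γ)) (P.V γ x r')) r :=
      (Filter.Tendsto.max (tendsto_const_nhds (x := (0 : ℝ))) hi').max hV.continuousAt
    convert this

lemma exists_netReward_eq_zero {r : ℝ} (hr : 0 < r) :
    ∃ γ, 0 < γ ∧ γ < r ∧ P.netReward γ r = 0 := by
  obtain ⟨γ, hγ, h0⟩ := intermediate_value_Icc' hr.le
    ((P.continuousOn_netReward hr.le).mono Set.Icc_subset_Ici_self)
    ⟨(P.netReward_self_neg hr).le, (P.netReward_zero_pos hr).le⟩
  refine ⟨γ, hγ.1.lt_of_ne ?_, hγ.2.lt_of_ne ?_, h0⟩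
  · rintro rfl
    exact (P.netReward_zero_pos hr).ne' h0
  · rintro rfl
    exact (P.netReward_self_neg hr).ne h0

/-- The sign of `V` matters only below `r`, where "1" is a sure loss; from `r` on, `V_lt` decides.
-/
lemma reward_feedbackA {γ r xv : ℝ} (hγ : 0 < γ) (hγr : γ ≤ r)
    (hlo : ∀ x, 0 ≤ x → x < xv → P.V γ x r ≤ 0) (hhi : ∀ x, xv ≤ x → x < r → 0 ≤ P.V γ x r)
    {x : ℝ} (hx : 0 ≤ x) :
    P.reward γ r x (feedbackA xv r x) = P.bestReward γ r x := by
  unfold feedbackA bestReward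
  by_cases h : r ≤ x
  · simp only [h, if_true, reward]
    have h0 : max 0 (r - γ) = r - γ := max_eq_right (by linarith)
    rw [h0, max_eq_left (P.V_lt hγ hγr x).le]
  · have h0 : max 0 (0 - γ) = 0 := max_eq_left (by linarith)
    by_cases h' : x < xv
    · simp only [h, h', if_true, if_false, reward, h0]
      rw [max_eq_left (hlo x hx h')]
    · simp only [h, h', if_false, reward, h0]
      rw [max_eq_right (hhi x (not_lt.1 h') (not_le.1 h))]

/-- Either `V` is already nonnegative at `0`, or it changes sign on `[0, r]`, where its root is
unique by strict monotonicity. -/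
lemma exists_threshold {γ r : ℝ} (hr : 0 < r) (hγr : γ < r) (h : 0 ≤ P.V γ r r) :
    ∃ xv, 0 ≤ xv ∧ xv ≤ r ∧ (∀ x, 0 ≤ x → (0 ≤ P.V γ x r ↔ xv ≤ x)) ∧
      (P.V γ xv r = 0 ∨ (xv = 0 ∧ 0 < P.V γ 0 r)) := by
  have hmono := P.V_strictMonoOn hr hγr
  rcases le_or_gt 0 (P.V γ 0 r) with h0 | h0
  · refine ⟨0, le_rfl, hr.le, fun x hx => ⟨fun _ => hx, fun _ => ?_⟩, ?_⟩
    · exact h0.trans (hmono.monotoneOn (Set.mem_Ici.2 le_rfl) hx hx)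
    · exact h0.eq_or_lt.imp Eq.symm fun h => ⟨rfl, h⟩
  · have hc : Continuous fun x => P.V γ x r :=
      P.continuous_V.comp (by fun_prop : Continuous fun x : ℝ => ((γ, x, r) : ℝ × ℝ × ℝ))
    obtain ⟨xv, hxv, hv⟩ := intermediate_value_Icc hr.le hc.continuousOn ⟨h0.le, h⟩
    simp only at hv
    refine ⟨xv, hxv.1, hxv.2, fun x hx => ?_, Or.inl hv⟩
    rw [← hv]
    exact hmono.le_iff_le hxv.1 hx

/-- Strategy A with a suitable threshold always selects a feedback of maximal net reward. -/
lemma exists_feedbackA_optimal {γ r : ℝ} (hr : 0 < r) (hγ : 0 < γ) (hγr : γ < r) :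
    ∃ xv, 0 ≤ xv ∧ xv ≤ r ∧
      ∀ x, 0 ≤ x → P.reward γ r x (feedbackA xv r x) = P.bestReward γ r x := by
  rcases le_or_gt 0 (P.V γ r r) with h | h
  · obtain ⟨xv, h0, h1, h2, -⟩ := P.exists_threshold hr hγr h
    refine ⟨xv, h0, h1, fun x hx => P.reward_feedbackA hγ hγr.le ?_ ?_ hx⟩
    · exact fun x hx hxv => le_of_not_ge fun h => absurd ((h2 x hx).1 h) (not_le.2 hxv)
    · exact fun x hxv _ => (h2 x (h0.trans hxv)).2 hxv
  -- When `V` is negative up to `r`, the threshold `xv = r` empties the probing interval.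
  · refine ⟨r, hr.le, le_rfl, fun x hx => P.reward_feedbackA hγ hγr.le ?_ ?_ hx⟩
    · exact fun x hx hxr => ((P.V_strictMonoOn hr hγr hx hr.le hxr).trans h).le
    · exact fun x h1 h2 => absurd h2 (not_lt.2 h1)

lemma feedbackA_self (r x : ℝ) : feedbackA r r x = feedbackB r x := by
  unfold feedbackA feedbackB
  by_cases h : r ≤ x
  · simp [h]
  · simp [h, not_le.1 h]

/-- The probability of successful second-level probing under Strategy A. -/
def probeIntegral (xv r : ℝ) : ℝ := ∫ u in Set.Ico xv r, (1 - P.G r u) ∂P.rateLaw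

lemma integrable_one_sub_G (r : ℝ) : Integrable (fun x => 1 - P.G r x) P.rateLaw :=
  Integrable.of_bound ((P.measurable_G r).const_sub 1).aestronglyMeasurable 1
    (Filter.Eventually.of_forall fun x => by
      have h0 := P.G_nonneg r x
      have h1 := P.G_le_one r x
      rw [Real.norm_of_nonneg (by linarith)]
      linarith)

lemma reward_feedbackA_eq {γ r xv : ℝ} (x : ℝ) :
    P.reward γ r x (feedbackA xv r x) =
      (Set.Ici r).indicator (fun _ => r - γ) x + (Set.Ico xv r).indicator (fun x => P.V γ x r) x := by
  unfold feedbackA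
  by_cases h : r ≤ x
  · have : ¬ x < r := not_lt.2 h
    simp [h, reward, Set.indicator, this]
  · by_cases h' : x < xv
    · have : ¬ xv ≤ x := not_le.2 h'
      simp [h, h', reward, Set.indicator, this]
    · simp [h, h', reward, Set.indicator, not_le.1 h, not_lt.1 h']

lemma integrable_V (γ r : ℝ) : Integrable (fun x => P.V γ x r) P.rateLaw := by
  unfold V
  exact ((P.integrable_one_sub_G r).const_mul _).sub (integrable_const _)

lemma integrable_reward_feedbackA (γ r xv : ℝ) :
    Integrable (fun x => P.reward γ r x (feedbackA xv r x)) P.rateLaw := by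
  simp_rw [reward_feedbackA_eq]
  exact ((integrable_const _).indicator measurableSet_Ici).add
    ((P.integrable_V γ r).indicator measurableSet_Ico)

lemma rateLaw_Ico {xv r : ℝ} (h0 : 0 ≤ xv) (h : xv ≤ r) :
    P.rateLaw.real (Set.Ico xv r) = Real.exp (-xv / P.mean) - Real.exp (-r / P.mean) := by
  rw [← P.rateLaw_Ici h0, ← P.rateLaw_Ici (h0.trans h), ← Set.Ici_sdiff_Ici]
  exact measureReal_sdiff (Set.Ici_subset_Ici.2 h) measurableSet_Ici

lemma integral_reward_feedbackA {γ r xv : ℝ} (h0 : 0 ≤ xv) (h : xv ≤ r) :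
    ∫ x, P.reward γ r x (feedbackA xv r x) ∂P.rateLaw =
      (r - γ) * Real.exp (-r / P.mean) + (1 - P.τ) * (r - γ) * P.probeIntegral xv r -
        γ * P.τ * (Real.exp (-xv / P.mean) - Real.exp (-r / P.mean)) := by
  simp_rw [reward_feedbackA_eq]
  rw [integral_add ((integrable_const _).indicator measurableSet_Ici)
    ((P.integrable_V γ r).indicator measurableSet_Ico),
    integral_indicator_const _ measurableSet_Ici, P.rateLaw_Ici (h0.trans h),
    integral_indicator measurableSet_Ico]
  unfold V
  rw [integral_sub ((P.integrable_one_sub_G r).const_mul _).integrableOn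
    (integrable_const _), integral_const_mul, setIntegral_const, P.rateLaw_Ico h0 h, probeIntegral]
  simp only [smul_eq_mul]
  ring

end Params

/-! ### Data and time of a single round -/

lemma measurableSet_feedback_eq {α : Type*} [MeasurableSpace α] {f : α → Feedback}
    (hf : Measurable f) (u : Feedback) : MeasurableSet {x | f x = u} :=
  hf (MeasurableSpace.measurableSet_top (s := {u}))

lemma measurableSet_bool_eq {α : Type*} [MeasurableSpace α] {s : α → Bool}
    (hs : Measurable s) : MeasurableSet {x | s x = true} :=
  hs (measurableSet_singleton true)

namespace Params
variable (P : Params)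

open Classical in
/-- The data received in a round with first feedback `u` and second decision `t`, when the rates
are `x` and `y` and the transmission rate is `r`. -/
def roundGain (r : ℝ) (u : Feedback) (t : Bool) (x y : ℝ) : ℝ :=
  match u with
  | .nack => 0
  | .ack => if r ≤ x then r else 0
  | .erasure => if t = true ∧ r ≤ y then (1 - P.τ) * r else 0

/-- The time spent in a round of `k` slots with first feedback `u` and second decision `t`. -/
def roundCost (u : Feedback) (t : Bool) (k : ℕ) : ℝ :=
  k * P.τ +
    match u with
    | .nack => 0
    | .ack => 1
    | .erasure => P.τ + if t = true then 1 - P.τ else 0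

lemma roundGain_nonneg {r : ℝ} (hr : 0 ≤ r) (u : Feedback) (t : Bool) (x y : ℝ) :
    0 ≤ P.roundGain r u t x y := by
  have hτ := P.τ_lt_one
  have : 0 ≤ (1 - P.τ) * r := mul_nonneg (by linarith) hr
  cases u <;> simp only [roundGain] <;> first | exact le_rfl | (split_ifs <;> simp [*])

lemma roundGain_le {r : ℝ} (hr : 0 ≤ r) (u : Feedback) (t : Bool) (x y : ℝ) :
    P.roundGain r u t x y ≤ r := by
  have hτ := mul_nonneg P.τ_pos.le hr
  cases u <;> simp only [roundGain] <;> first | exact hr | (split_ifs <;> nlinarith)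

lemma le_roundCost (u : Feedback) (t : Bool) (k : ℕ) : k * P.τ ≤ P.roundCost u t k := by
  have hτ := P.τ_lt_one
  have hτ0 := P.τ_pos
  cases u <;> simp only [roundCost] <;> first | linarith | (split_ifs <;> linarith)

lemma roundCost_nonneg (u : Feedback) (t : Bool) (k : ℕ) : 0 ≤ P.roundCost u t k :=
  (mul_nonneg k.cast_nonneg P.τ_pos.le).trans (P.le_roundCost u t k)

lemma roundCost_le (u : Feedback) (t : Bool) (k : ℕ) : P.roundCost u t k ≤ k * P.τ + 1 := by
  have hτ := P.τ_lt_one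
  have hτ0 := P.τ_pos
  cases u <;> simp only [roundCost] <;> first | linarith | (split_ifs <;> linarith)

section Measurability
variable {α : Type*} [MeasurableSpace α] {u : α → Feedback} {t : α → Bool}

lemma measurable_roundGain (r : ℝ) (hu : Measurable u) (ht : Measurable t) {x y : α → ℝ}
    (hx : Measurable x) (hy : Measurable y) :
    Measurable fun z => P.roundGain r (u z) (t z) (x z) (y z) := by
  classical
  have e : (fun z => P.roundGain r (u z) (t z) (x z) (y z)) = fun z =>
      if u z = .ack then (if r ≤ x z then r else 0) else
        if u z = .erasure then (if t z = true ∧ r ≤ y z then (1 - P.τ) * r else 0) else 0 := by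
    funext z
    cases h : u z <;> simp [roundGain]
  rw [e]
  refine Measurable.ite (measurableSet_feedback_eq hu _)
    (Measurable.ite (measurableSet_le measurable_const hx) measurable_const measurable_const)
    (Measurable.ite (measurableSet_feedback_eq hu _)
      (Measurable.ite ?_ measurable_const measurable_const) measurable_const)
  exact (measurableSet_bool_eq ht).inter (measurableSet_le measurable_const hy)

lemma measurable_roundCost (hu : Measurable u) (ht : Measurable t) {k : α → ℕ}
    (hk : Measurable k) : Measurable fun z => P.roundCost (u z) (t z) (k z) := by
  classical
  have e : (fun z => P.roundCost (u z) (t z) (k z)) = fun z => k z * P.τ +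
      if u z = .ack then 1 else
        if u z = .erasure then (P.τ + if t z = true then 1 - P.τ else 0) else 0 := by
    funext z
    cases h : u z <;> simp [roundCost]
  rw [e]
  have hk' : Measurable fun z => (k z : ℝ) := measurable_from_nat.comp hk
  refine (hk'.mul_const _).add (Measurable.ite (measurableSet_feedback_eq hu _) measurable_const
    (Measurable.ite (measurableSet_feedback_eq hu _)
      (measurable_const.add (Measurable.ite (measurableSet_bool_eq ht) measurable_const
        measurable_const)) measurable_const))

end Measurability

instance : IsProbabilityMeasure P.slotLaw :=
  Measure.isProbabilityMeasure_map (by fun_prop)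

/-- The mean number of slots; `n + 1` appears because the geometric law starts at `0` and the slot
count at `1`. -/
lemma hasSum_slots : HasSum (fun n : ℕ => ((1 - (P.ps : ℝ)) ^ n * P.ps) * ((n + 1 : ℕ) : ℝ))
    (1 / P.ps) := by
  have hp := P.ps_real_pos
  have hp1 : (P.ps : ℝ) ≤ 1 := P.ps.2.2
  have hlt : ‖1 - (P.ps : ℝ)‖ < 1 := by
    rw [Real.norm_of_nonneg (by linarith)]; linarith
  have h1 := hasSum_coe_mul_geometric_of_norm_lt_one hlt
  have h2 := hasSum_geometric_of_norm_lt_one hlt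
  have h := (h1.add h2).mul_right (P.ps : ℝ)
  have e1 : (fun n : ℕ => ((1 - (P.ps : ℝ)) ^ n * P.ps) * ((n + 1 : ℕ) : ℝ)) =
      fun n : ℕ => ((n : ℝ) * (1 - (P.ps : ℝ)) ^ n + (1 - (P.ps : ℝ)) ^ n) * P.ps := by
    funext n
    push_cast
    ring
  have e2 : 1 / (P.ps : ℝ) = ((1 - (P.ps : ℝ)) / (1 - (1 - (P.ps : ℝ))) ^ 2 +
      (1 - (1 - (P.ps : ℝ)))⁻¹) * P.ps := by
    rw [sub_sub_cancel]
    field_simp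
    ring
  rw [e1, e2]
  exact h

lemma integrable_slotLaw : Integrable (fun k : ℕ => (k : ℝ)) P.slotLaw := by
  refine (integrable_map_measure (by fun_prop) (by fun_prop)).2 ?_
  refine (integrable_geometricMeasure_iff P.ps_pos.ne').2 ?_
  convert P.hasSum_slots.summable using 1
  funext n
  rw [Function.comp_apply, Real.norm_of_nonneg (Nat.cast_nonneg _)]

lemma integral_slotLaw : ∫ k : ℕ, (k : ℝ) ∂P.slotLaw = 1 / P.ps := by
  rw [slotLaw, integral_map (by fun_prop) (by fun_prop), integral_geometricMeasure P.ps_pos.ne']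
  exact P.hasSum_slots.tsum_eq

/-- The joint law of the number of slots, the first-level estimate and its refinement. -/
def roundLaw : Measure (ℕ × ℂ × ℂ) :=
  P.slotLaw.prod ((complexGaussian P.v).prod (complexGaussian P.w))

instance : IsProbabilityMeasure P.roundLaw := by unfold roundLaw; infer_instance

/-- The observed quantities `(K, R⁽¹⁾, R⁽²⁾)` of a round. -/
def observe (z : ℕ × ℂ × ℂ) : ℕ × ℝ × ℝ :=
  (z.1, P.a * ‖z.2.1‖ ^ 2, P.b * ‖z.2.1 + z.2.2‖ ^ 2)

lemma measurable_observe : Measurable P.observe := by unfold observe; fun_prop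

section Round
variable {P} {f : ℕ × ℝ → Feedback} {s : ℕ × ℝ × ℝ → Bool} {r γ : ℝ}

/-- The data received in a round, as a function of the underlying variables. -/
def gain (P : Params) (r : ℝ) (f : ℕ × ℝ → Feedback) (s : ℕ × ℝ × ℝ → Bool) (z : ℕ × ℂ × ℂ) : ℝ :=
  P.roundGain r (f ((P.observe z).1, (P.observe z).2.1)) (s (P.observe z)) (P.observe z).2.1
    (P.observe z).2.2

/-- The time spent in a round, as a function of the underlying variables. -/
def cost (P : Params) (f : ℕ × ℝ → Feedback) (s : ℕ × ℝ × ℝ → Bool) (z : ℕ × ℂ × ℂ) : ℝ :=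
  P.roundCost (f ((P.observe z).1, (P.observe z).2.1)) (s (P.observe z)) (P.observe z).1

lemma measurable_gain (hf : Measurable f) (hs : Measurable s) : Measurable (P.gain r f s) := by
  have h := P.measurable_observe
  exact P.measurable_roundGain r (hf.comp (by fun_prop)) (hs.comp h) (by fun_prop) (by fun_prop)

lemma measurable_cost (hf : Measurable f) (hs : Measurable s) : Measurable (P.cost f s) := by
  have h := P.measurable_observe
  exact P.measurable_roundCost (hf.comp (by fun_prop)) (hs.comp h) (by fun_prop)

lemma gain_nonneg (hr : 0 ≤ r) (z : ℕ × ℂ × ℂ) : 0 ≤ P.gain r f s z :=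
  P.roundGain_nonneg hr _ _ _ _

lemma gain_le (hr : 0 ≤ r) (z : ℕ × ℂ × ℂ) : P.gain r f s z ≤ r :=
  P.roundGain_le hr _ _ _ _

lemma cost_nonneg (z : ℕ × ℂ × ℂ) : 0 ≤ P.cost f s z := P.roundCost_nonneg _ _ _

lemma cost_le (z : ℕ × ℂ × ℂ) : P.cost f s z ≤ z.1 * P.τ + 1 := P.roundCost_le _ _ _

lemma integrable_gain (hf : Measurable f) (hs : Measurable s) (hr : 0 ≤ r) :
    Integrable (P.gain r f s) P.roundLaw :=
  Integrable.of_bound (measurable_gain hf hs).aestronglyMeasurable r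
    (Filter.Eventually.of_forall fun z => by
      rw [Real.norm_of_nonneg (gain_nonneg hr z)]
      exact gain_le hr z)

lemma integrable_slots : Integrable (fun z : ℕ × ℂ × ℂ => (z.1 : ℝ)) P.roundLaw :=
  P.integrable_slotLaw.comp_fst _

lemma integral_slots : ∫ z, (z.1 : ℝ) ∂P.roundLaw = 1 / P.ps := by
  rw [roundLaw, integral_fun_fst (fun k : ℕ => (k : ℝ)), P.integral_slotLaw]
  simp

lemma integrable_cost (hf : Measurable f) (hs : Measurable s) :
    Integrable (P.cost f s) P.roundLaw := by
  refine ((integrable_slots.mul_const P.τ).add (integrable_const 1)).mono'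
    (measurable_cost hf hs).aestronglyMeasurable (Filter.Eventually.of_forall fun z => ?_)
  rw [Real.norm_of_nonneg (cost_nonneg z)]
  exact cost_le z

/-- Fubini in the order of observation: a bound on the mean over `e`, given `K` and the first-level
estimate, is averaged over both. The term linear in `k` is the contention cost. -/
lemma integral_roundLaw_le {F : ℕ × ℂ × ℂ → ℝ} {B : ℝ → ℝ} {C : ℝ}
    (hF : Integrable F P.roundLaw)
    (hFk : ∀ k, Integrable (fun z => F (k, z)) ((complexGaussian P.v).prod (complexGaussian P.w)))
    (hB : Integrable B P.rateLaw)
    (h : ∀ k h, ∫ e, F (k, h, e) ∂complexGaussian P.w ≤ B (P.a * ‖h‖ ^ 2) + C * k) :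
    ∫ z, F z ∂P.roundLaw ≤ ∫ x, B x ∂P.rateLaw + C * (1 / P.ps) := by
  have hBh : Integrable (fun h : ℂ => B (P.a * ‖h‖ ^ 2)) (complexGaussian P.v) :=
    hB.comp_measurable (by fun_prop)
  have hBe : ∫ x, B x ∂P.rateLaw = ∫ h, B (P.a * ‖h‖ ^ 2) ∂complexGaussian P.v :=
    integral_map (by fun_prop) hB.aestronglyMeasurable
  have hk : ∀ k, ∫ z, F (k, z) ∂((complexGaussian P.v).prod (complexGaussian P.w)) ≤
      ∫ x, B x ∂P.rateLaw + C * k := by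
    intro k
    rw [integral_prod _ (hFk k), hBe]
    refine (integral_mono (hFk k).integral_prod_left (hBh.add (integrable_const (C * (k : ℝ))))
      (h k)).trans_eq ?_
    rw [integral_add' hBh (integrable_const _)]
    simp
  rw [roundLaw, integral_prod _ hF]
  refine (integral_mono hF.integral_prod_left ((integrable_const (∫ x, B x ∂P.rateLaw)).add
    (P.integrable_slotLaw.const_mul C)) hk).trans_eq ?_
  rw [integral_add' (integrable_const _) (P.integrable_slotLaw.const_mul C), integral_const_mul,
    P.integral_slotLaw]
  simp

lemma measurable_netGain (hf : Measurable f) (hs : Measurable s) :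
    Measurable (fun z => P.gain r f s z - γ * P.cost f s z) :=
  (measurable_gain hf hs).sub ((measurable_cost hf hs).const_mul γ)

lemma abs_netGain_le (hr : 0 ≤ r) (hγ : 0 ≤ γ) (z : ℕ × ℂ × ℂ) :
    ‖P.gain r f s z - γ * P.cost f s z‖ ≤ r + γ * (z.1 * P.τ + 1) := by
  have h1 := gain_nonneg (P := P) (f := f) (s := s) hr z
  have h2 := gain_le (P := P) (f := f) (s := s) hr z
  have h3 := mul_nonneg hγ (cost_nonneg (P := P) (f := f) (s := s) z)
  have h4 := mul_le_mul_of_nonneg_left (cost_le (P := P) (f := f) (s := s) z) hγ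
  rw [Real.norm_eq_abs, abs_le]
  constructor <;> linarith

lemma integrable_netGain_section (hf : Measurable f) (hs : Measurable s) (hr : 0 ≤ r) (hγ : 0 ≤ γ)
    (k : ℕ) : Integrable (fun z => P.gain r f s (k, z) - γ * P.cost f s (k, z))
      ((complexGaussian P.v).prod (complexGaussian P.w)) :=
  Integrable.of_bound ((measurable_netGain hf hs).comp (by fun_prop)).aestronglyMeasurable
    (r + γ * (k * P.τ + 1)) (Filter.Eventually.of_forall fun z => abs_netGain_le hr hγ (k, z))

lemma integral_indicator_R2 (P : Params) (r c : ℝ) (h : ℂ) :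
    ∫ e, ({e : ℂ | r ≤ P.b * ‖h + e‖ ^ 2}.indicator (fun _ => c) e) ∂complexGaussian P.w =
      c * (1 - P.G r (P.a * ‖h‖ ^ 2)) := by
  rw [integral_indicator_const _ (measurableSet_le (by fun_prop) (by fun_prop)), one_sub_G_eq,
    smul_eq_mul, mul_comm]

/-- The conditional expectation of the net gain of a round given `K` and the first-level
estimate. -/
lemma integral_netGain_le (hf : Measurable f) (hs : Measurable s) (hγ : 0 ≤ γ) (hγr : γ ≤ r)
    (k : ℕ) (h : ℂ) :
    ∫ e, (P.gain r f s (k, h, e) - γ * P.cost f s (k, h, e)) ∂complexGaussian P.w ≤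
      P.reward γ r (P.a * ‖h‖ ^ 2) (f (k, P.a * ‖h‖ ^ 2)) + -(γ * P.τ) * k := by
  have hτ := P.τ_lt_one
  have hms : MeasurableSet {e : ℂ | r ≤ P.b * ‖h + e‖ ^ 2} :=
    measurableSet_le (by fun_prop) (by fun_prop)
  have hc : 0 ≤ (1 - P.τ) * (r - γ) := mul_nonneg (by linarith) (by linarith)
  have hind := integral_indicator_R2 P r ((1 - P.τ) * (r - γ)) h
  have hii : Integrable ({e : ℂ | r ≤ P.b * ‖h + e‖ ^ 2}.indicator
      (fun _ => (1 - P.τ) * (r - γ))) (complexGaussian P.w) :=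
    (integrable_const _).indicator hms
  have hint : Integrable (fun e => P.gain r f s (k, h, e) - γ * P.cost f s (k, h, e))
      (complexGaussian P.w) :=
    Integrable.of_bound ((measurable_netGain hf hs).comp (by fun_prop)).aestronglyMeasurable
      (r + γ * (k * P.τ + 1)) (Filter.Eventually.of_forall fun e =>
        abs_netGain_le (hγ.trans hγr) hγ (k, h, e))
  cases hu : f (k, P.a * ‖h‖ ^ 2)
  · simp [gain, cost, observe, hu, roundGain, roundCost, reward]
    linarith
  · by_cases hr' : r ≤ P.a * ‖h‖ ^ 2 <;>
      simp [gain, cost, observe, hu, roundGain, roundCost, reward, hr'] <;> linarith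
  -- After "e", transmitting when `R⁽²⁾ < r` wastes `γ (1 - τ)`, and deferring when `R⁽²⁾ ≥ r`
  -- forgoes `(1 - τ)(r - γ) ≥ 0`; no second decision beats "transmit iff `R⁽²⁾ ≥ r`".
  · have hle : ∀ e, P.gain r f s (k, h, e) - γ * P.cost f s (k, h, e) ≤
        {e : ℂ | r ≤ P.b * ‖h + e‖ ^ 2}.indicator (fun _ => (1 - P.τ) * (r - γ)) e +
          (-(γ * P.τ) + -(γ * P.τ) * k) := by
      intro e
      have h1 : 0 ≤ γ * (1 - P.τ) := mul_nonneg hγ (by linarith)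
      by_cases ht : s (k, P.a * ‖h‖ ^ 2, P.b * ‖h + e‖ ^ 2) = true <;>
        by_cases hR : r ≤ P.b * ‖h + e‖ ^ 2 <;>
        simp [gain, cost, observe, hu, roundGain, roundCost, Set.indicator, ht, hR] <;> nlinarith
    refine (integral_mono hint (hii.add (integrable_const _)) hle).trans_eq ?_
    rw [integral_add' hii (integrable_const _), hind]
    simp [reward, V]
    ring

/-- With the best second decision there is no slack in `integral_netGain_le`. -/
lemma integral_netGain_decide (k : ℕ) (h : ℂ) :
    ∫ e, (P.gain r f (fun o => decide (r ≤ o.2.2)) (k, h, e) -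
        γ * P.cost f (fun o => decide (r ≤ o.2.2)) (k, h, e)) ∂complexGaussian P.w =
      P.reward γ r (P.a * ‖h‖ ^ 2) (f (k, P.a * ‖h‖ ^ 2)) + -(γ * P.τ) * k := by
  have hms : MeasurableSet {e : ℂ | r ≤ P.b * ‖h + e‖ ^ 2} :=
    measurableSet_le (by fun_prop) (by fun_prop)
  have hind := integral_indicator_R2 P r ((1 - P.τ) * (r - γ)) h
  have hii : Integrable ({e : ℂ | r ≤ P.b * ‖h + e‖ ^ 2}.indicator
      (fun _ => (1 - P.τ) * (r - γ))) (complexGaussian P.w) :=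
    (integrable_const _).indicator hms
  cases hu : f (k, P.a * ‖h‖ ^ 2)
  · simp [gain, cost, observe, hu, roundGain, roundCost, reward]
    ring
  · by_cases hr' : r ≤ P.a * ‖h‖ ^ 2 <;>
      simp [gain, cost, observe, hu, roundGain, roundCost, reward, hr'] <;> ring
  · have hle : ∀ e, P.gain r f (fun o => decide (r ≤ o.2.2)) (k, h, e) -
        γ * P.cost f (fun o => decide (r ≤ o.2.2)) (k, h, e) =
        {e : ℂ | r ≤ P.b * ‖h + e‖ ^ 2}.indicator (fun _ => (1 - P.τ) * (r - γ)) e +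
          (-(γ * P.τ) + -(γ * P.τ) * k) := by
      intro e
      by_cases hR : r ≤ P.b * ‖h + e‖ ^ 2 <;>
        simp [gain, cost, observe, hu, roundGain, roundCost, Set.indicator, hR] <;> ring
    simp_rw [hle]
    rw [integral_add hii (integrable_const _), hind]
    simp [reward, V]
    ring

lemma lintegral_gain (hf : Measurable f) (hs : Measurable s) (hr : 0 ≤ r) :
    ∫⁻ z, ENNReal.ofReal (P.gain r f s z) ∂P.roundLaw =
      ENNReal.ofReal (∫ z, P.gain r f s z ∂P.roundLaw) :=
  (ofReal_integral_eq_lintegral_ofReal (integrable_gain hf hs hr)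
    (Filter.Eventually.of_forall fun z => gain_nonneg hr z)).symm

lemma lintegral_cost (hf : Measurable f) (hs : Measurable s) :
    ∫⁻ z, ENNReal.ofReal (P.cost f s z) ∂P.roundLaw =
      ENNReal.ofReal (∫ z, P.cost f s z ∂P.roundLaw) :=
  (ofReal_integral_eq_lintegral_ofReal (integrable_cost hf hs)
    (Filter.Eventually.of_forall fun z => cost_nonneg z)).symm

/-- If the net reward of the feedback is dominated by `B`, whose mean does not exceed the price
of contention, then the data received in a round are worth at most `γ` times the time spent. -/
lemma lintegral_gain_le (hf : Measurable f) (hs : Measurable s) (hγ : 0 ≤ γ) (hγr : γ ≤ r)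
    {B : ℝ → ℝ} (hB : Integrable B P.rateLaw)
    (h : ∀ k x, 0 ≤ x → P.reward γ r x (f (k, x)) ≤ B x)
    (hBle : ∫ x, B x ∂P.rateLaw ≤ γ * (P.τ / P.ps)) :
    ∫⁻ z, ENNReal.ofReal (P.gain r f s z) ∂P.roundLaw ≤
      ENNReal.ofReal γ * ∫⁻ z, ENNReal.ofReal (P.cost f s z) ∂P.roundLaw := by
  have hr := hγ.trans hγr
  rw [lintegral_gain hf hs hr, lintegral_cost hf hs, ← ENNReal.ofReal_mul hγ]
  refine ENNReal.ofReal_le_ofReal ?_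
  have := integral_roundLaw_le (C := -(γ * P.τ))
    ((integrable_gain hf hs hr).sub ((integrable_cost hf hs).const_mul γ))
    (integrable_netGain_section hf hs hr hγ) hB fun k z =>
      (integral_netGain_le hf hs hγ hγr k z).trans
        (add_le_add_left (h k _ (mul_nonneg P.a_pos.le (sq_nonneg _))) _)
  rw [integral_sub' (integrable_gain hf hs hr) ((integrable_cost hf hs).const_mul γ),
    integral_const_mul] at this
  have e : -(γ * P.τ) * (1 / (P.ps : ℝ)) = -(γ * (P.τ / P.ps)) := by ring
  linarith

lemma lintegral_gain_decide (hf : Measurable f) (hγ : 0 ≤ γ) (hγr : γ ≤ r)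
    {B : ℝ → ℝ} (hB : Integrable B P.rateLaw)
    (h : ∀ k x, 0 ≤ x → P.reward γ r x (f (k, x)) = B x)
    (hBeq : ∫ x, B x ∂P.rateLaw = γ * (P.τ / P.ps)) :
    ∫⁻ z, ENNReal.ofReal (P.gain r f (fun o => decide (r ≤ o.2.2)) z) ∂P.roundLaw =
      ENNReal.ofReal γ *
        ∫⁻ z, ENNReal.ofReal (P.cost f (fun o => decide (r ≤ o.2.2)) z) ∂P.roundLaw := by
  have hr := hγ.trans hγr
  have hs : Measurable fun o : ℕ × ℝ × ℝ => decide (r ≤ o.2.2) :=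
    (measurable_decide_le r).comp (by fun_prop)
  refine le_antisymm (lintegral_gain_le hf hs hγ hγr hB (fun k x hx => (h k x hx).le) hBeq.le) ?_
  rw [lintegral_gain hf hs hr, lintegral_cost hf hs, ← ENNReal.ofReal_mul hγ]
  refine ENNReal.ofReal_le_ofReal ?_
  -- The reverse inequality is the same averaging bound applied to the negated net gain.
  have := integral_roundLaw_le (C := γ * P.τ) (B := fun x => -B x)
    ((integrable_gain hf hs hr).sub ((integrable_cost hf hs).const_mul γ)).neg
    (fun k => (integrable_netGain_section hf hs hr hγ k).neg) hB.neg fun k z => by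
      simp only [Pi.neg_apply, Pi.sub_apply]
      rw [integral_neg, integral_netGain_decide,
        h k _ (mul_nonneg P.a_pos.le (sq_nonneg _))]
      linarith
  rw [integral_neg', integral_sub' (integrable_gain hf hs hr) ((integrable_cost hf hs).const_mul γ),
    integral_const_mul, integral_neg] at this
  have e : (γ * P.τ) * (1 / (P.ps : ℝ)) = (γ * (P.τ / P.ps)) := by ring
  linarith

lemma lintegral_cost_pos (hf : Measurable f) (hs : Measurable s) :
    0 < ∫⁻ z, ENNReal.ofReal (P.cost f s z) ∂P.roundLaw := by
  rw [lintegral_cost hf hs, ENNReal.ofReal_pos]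
  have h := integral_mono (integrable_slots.mul_const P.τ) (integrable_cost hf hs)
    fun z => P.le_roundCost _ _ z.1
  rw [integral_mul_const, integral_slots] at h
  have := P.ps_real_pos
  have := P.τ_pos
  exact lt_of_lt_of_le (by positivity) h

lemma lintegral_cost_ne_top (hf : Measurable f) (hs : Measurable s) :
    ∫⁻ z, ENNReal.ofReal (P.cost f s z) ∂P.roundLaw ≠ ∞ := by
  rw [lintegral_cost hf hs]
  exact ENNReal.ofReal_ne_top

end Round
end Params

/-! ### Independence of a round from its past, and the pasts without transmission -/

namespace Probing

variable {P : Params} {Ω : Type*} [MeasurableSpace Ω] {μ : Measure Ω} (M : Probing P μ)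

/-- The underlying variables of round `n`. -/
def sample (n : ℕ) (ω : Ω) : ℕ × ℂ × ℂ := (M.K n ω, M.h n ω, M.e n ω)

lemma measurable_sample (n : ℕ) : Measurable (M.sample n) :=
  (M.measurable_K n).prodMk ((M.measurable_h n).prodMk (M.measurable_e n))

lemma map_sample (n : ℕ) : μ.map (M.sample n) = P.roundLaw := M.law n

lemma measurable_past (n : ℕ) : Measurable (M.past n) :=
  measurable_pi_lambda _ fun j => P.measurable_observe.comp (M.measurable_sample j)

/-- The past is a function of the samples with index below `n`, a block disjoint from `{n}`. -/
lemma map_past_sample [IsProbabilityMeasure μ] (n : ℕ) :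
    μ.map (fun ω => (M.past n ω, M.sample n ω)) = (μ.map (M.past n)).prod P.roundLaw := by
  have hi := M.indep.indepFun_finset (Finset.range n) {n} (by simp)
    (fun i => M.measurable_sample i)
  have hc : IndepFun (M.past n) (M.sample n) μ :=
    hi.comp (φ := fun (q : Finset.range n → ℕ × ℂ × ℂ) (j : Fin n) =>
        P.observe (q ⟨j, Finset.mem_range.2 j.2⟩))
      (ψ := fun q : ({n} : Finset ℕ) → ℕ × ℂ × ℂ => q ⟨n, Finset.mem_singleton_self n⟩)
      (measurable_pi_lambda _ fun j => P.measurable_observe.comp (measurable_pi_apply _))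
      (measurable_pi_apply _)
  rw [(indepFun_iff_map_prod_eq_prod_map_map (M.measurable_past n).aemeasurable
    (M.measurable_sample n).aemeasurable).1 hc, M.map_sample]

end Probing

/-- The first-level rule of a policy in round `n`, for a given past. -/
def Policy.firstRule (π : Policy) (n : ℕ) (q : Fin n → ℕ × ℝ × ℝ) (o : ℕ × ℝ) : Feedback :=
  π.first n (q, o)

/-- The second-level rule of a policy in round `n`, for a given past. -/
def Policy.secondRule (π : Policy) (n : ℕ) (q : Fin n → ℕ × ℝ × ℝ) (o : ℕ × ℝ × ℝ) : Bool :=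
  π.second n (q, o)

lemma Policy.measurable_firstRule (π : Policy) (n : ℕ) (q : Fin n → ℕ × ℝ × ℝ) :
    Measurable (π.firstRule n q) :=
  (π.measurable_first n).comp measurable_prodMk_left

lemma Policy.measurable_secondRule (π : Policy) (n : ℕ) (q : Fin n → ℕ × ℝ × ℝ) :
    Measurable (π.secondRule n q) :=
  (π.measurable_second n).comp measurable_prodMk_left

/-- The policy transmits in round `n` for the given past and observation. -/
def Policy.TransmitsAt (π : Policy) (n : ℕ) (q : Fin n → ℕ × ℝ × ℝ) (o : ℕ × ℝ × ℝ) : Prop :=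
  π.first n (q, o.1, o.2.1) = .ack ∨
    (π.first n (q, o.1, o.2.1) = .erasure ∧ π.second n (q, o) = true)

lemma Policy.measurableSet_transmitsAt (π : Policy) (n : ℕ) :
    MeasurableSet {x : (Fin n → ℕ × ℝ × ℝ) × ℕ × ℝ × ℝ | π.TransmitsAt n x.1 x.2} := by
  have hf : Measurable fun x : (Fin n → ℕ × ℝ × ℝ) × ℕ × ℝ × ℝ =>
      π.first n (x.1, x.2.1, x.2.2.1) := (π.measurable_first n).comp (by fun_prop)
  have hs : Measurable fun x : (Fin n → ℕ × ℝ × ℝ) × ℕ × ℝ × ℝ =>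
      π.second n (x.1, x.2) := (π.measurable_second n).comp (by fun_prop)
  exact (measurableSet_feedback_eq hf _).union
    ((measurableSet_feedback_eq hf _).inter (measurableSet_bool_eq hs))

/-- The pasts of length `n` for which the policy has not transmitted yet. -/
def Policy.waitSet (π : Policy) : (n : ℕ) → Set (Fin n → ℕ × ℝ × ℝ)
  | 0 => Set.univ
  | n + 1 => {q | Fin.init q ∈ π.waitSet n ∧ ¬ π.TransmitsAt n (Fin.init q) (q (Fin.last n))}

lemma Policy.measurableSet_waitSet (π : Policy) (n : ℕ) : MeasurableSet (π.waitSet n) := by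
  induction n with
  | zero => exact MeasurableSet.univ
  | succ n ih =>
    have hi : Measurable fun q : Fin (n + 1) → ℕ × ℝ × ℝ => (Fin.init q : Fin n → ℕ × ℝ × ℝ) :=
      measurable_pi_lambda _ fun j => measurable_pi_apply _
    have hp : Measurable fun q : Fin (n + 1) → ℕ × ℝ × ℝ =>
        ((Fin.init q : Fin n → ℕ × ℝ × ℝ), q (Fin.last n)) := hi.prodMk (measurable_pi_apply _)
    exact (hi ih).inter (hp (π.measurableSet_transmitsAt n)).compl

/-! ### Summation over the reached rounds, and throughput -/

namespace Probing

variable {P : Params} {Ω : Type*} [MeasurableSpace Ω] {μ : Measure Ω} (M : Probing P μ)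

lemma reached_succ_iff (π : Policy) (n : ℕ) (ω : Ω) :
    M.Reached π (n + 1) ω ↔ M.Reached π n ω ∧ ¬ M.Transmits π n ω := by
  unfold Reached
  constructor
  · exact fun h => ⟨fun j hj => h j (hj.trans n.lt_succ_self), h n n.lt_succ_self⟩
  · rintro ⟨h1, h2⟩ j hj
    rcases Nat.lt_succ_iff_lt_or_eq.1 hj with h | rfl
    exacts [h1 j h, h2]

/-- Whether round `n` is reached is decided by the past alone, hence independently of the sample of
round `n`. -/
lemma reached_iff (π : Policy) (n : ℕ) (ω : Ω) :
    M.Reached π n ω ↔ M.past n ω ∈ π.waitSet n := by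
  induction n with
  | zero => simp [Reached, Policy.waitSet]
  | succ n ih => rw [reached_succ_iff, ih]; exact Iff.rfl

-- Conditionally on a past in `waitSet`, the current sample still has law `roundLaw`, so
-- single-round estimates apply past by past.
open Classical in
lemma lintegral_reached [IsProbabilityMeasure μ] (π : Policy) (n : ℕ)
    {φ : (Fin n → ℕ × ℝ × ℝ) × ℕ × ℂ × ℂ → ℝ≥0∞} (hφ : Measurable φ) :
    ∫⁻ ω, (if M.Reached π n ω then φ (M.past n ω, M.sample n ω) else 0) ∂μ =
      ∫⁻ q in π.waitSet n, ∫⁻ z, φ (q, z) ∂P.roundLaw ∂(μ.map (M.past n)) := by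
  have hS : MeasurableSet {x : (Fin n → ℕ × ℝ × ℝ) × ℕ × ℂ × ℂ | x.1 ∈ π.waitSet n} :=
    measurable_fst (π.measurableSet_waitSet n)
  have e : (fun ω => if M.Reached π n ω then φ (M.past n ω, M.sample n ω) else 0) = fun ω =>
      ({x : (Fin n → ℕ × ℝ × ℝ) × ℕ × ℂ × ℂ | x.1 ∈ π.waitSet n}.indicator φ)
        (M.past n ω, M.sample n ω) := by
    funext ω
    simp [Set.indicator, M.reached_iff]
  rw [e, ← lintegral_map (hφ.indicator hS)
    ((M.measurable_past n).prodMk (M.measurable_sample n)), M.map_past_sample,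
    lintegral_prod _ (hφ.indicator hS).aemeasurable,
    ← lintegral_indicator (π.measurableSet_waitSet n)]
  refine lintegral_congr fun q => ?_
  by_cases hq : q ∈ π.waitSet n <;> simp [Set.indicator, hq]

lemma roundData_eq (π : Policy) (r : ℝ) (n : ℕ) (ω : Ω) : M.roundData π r n ω =
    P.gain r (π.firstRule n (M.past n ω)) (π.secondRule n (M.past n ω)) (M.sample n ω) := by
  have h1 : π.firstRule n (M.past n ω)
    ((P.observe (M.sample n ω)).1, (P.observe (M.sample n ω)).2.1) = M.firstFeedback π n ω := rfl
  have h2 : π.secondRule n (M.past n ω) (P.observe (M.sample n ω)) = M.secondFeedback π n ω := rfl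
  unfold roundData Params.gain
  rw [h1, h2]
  cases M.firstFeedback π n ω <;> rfl

lemma roundTime_eq (π : Policy) (n : ℕ) (ω : Ω) : M.roundTime π n ω =
    P.cost (π.firstRule n (M.past n ω)) (π.secondRule n (M.past n ω)) (M.sample n ω) := by
  have h1 : π.firstRule n (M.past n ω)
    ((P.observe (M.sample n ω)).1, (P.observe (M.sample n ω)).2.1) = M.firstFeedback π n ω := rfl
  have h2 : π.secondRule n (M.past n ω) (P.observe (M.sample n ω)) = M.secondFeedback π n ω := rfl
  unfold roundTime Params.cost
  rw [h1, h2]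
  cases M.firstFeedback π n ω <;> rfl

lemma measurable_gain_section (P : Params) (π : Policy) (r : ℝ) (n : ℕ) :
    Measurable fun x : (Fin n → ℕ × ℝ × ℝ) × ℕ × ℂ × ℂ =>
      ENNReal.ofReal (P.gain r (π.firstRule n x.1) (π.secondRule n x.1) x.2) := by
  have h := P.measurable_observe
  exact (P.measurable_roundGain r ((π.measurable_first n).comp (by fun_prop))
    ((π.measurable_second n).comp (by fun_prop)) (by fun_prop) (by fun_prop)).ennreal_ofReal

lemma measurable_cost_section (P : Params) (π : Policy) (n : ℕ) :
    Measurable fun x : (Fin n → ℕ × ℝ × ℝ) × ℕ × ℂ × ℂ =>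
      ENNReal.ofReal (P.cost (π.firstRule n x.1) (π.secondRule n x.1) x.2) := by
  have h := P.measurable_observe
  exact (P.measurable_roundCost ((π.measurable_first n).comp (by fun_prop))
    ((π.measurable_second n).comp (by fun_prop)) (by fun_prop)).ennreal_ofReal

lemma measurableSet_reached (π : Policy) (n : ℕ) : MeasurableSet {ω | M.Reached π n ω} := by
  simp_rw [M.reached_iff]
  exact M.measurable_past n (π.measurableSet_waitSet n)

lemma lintegral_totalData [IsProbabilityMeasure μ] (π : Policy) (r : ℝ) :
    ∫⁻ ω, M.totalData π r ω ∂μ = ∑' n, ∫⁻ q in π.waitSet n,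
      ∫⁻ z, ENNReal.ofReal (P.gain r (π.firstRule n q) (π.secondRule n q) z) ∂P.roundLaw
        ∂(μ.map (M.past n)) := by
  unfold totalData
  simp_rw [M.roundData_eq]
  rw [lintegral_tsum]
  · exact tsum_congr fun n => M.lintegral_reached π n (measurable_gain_section P π r n)
  · exact fun n => (Measurable.ite (M.measurableSet_reached π n)
      ((measurable_gain_section P π r n).comp ((M.measurable_past n).prodMk
        (M.measurable_sample n))) measurable_const).aemeasurable

lemma lintegral_totalTime [IsProbabilityMeasure μ] (π : Policy) :
    ∫⁻ ω, M.totalTime π ω ∂μ = ∑' n, ∫⁻ q in π.waitSet n,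
      ∫⁻ z, ENNReal.ofReal (P.cost (π.firstRule n q) (π.secondRule n q) z) ∂P.roundLaw
        ∂(μ.map (M.past n)) := by
  unfold totalTime
  simp_rw [M.roundTime_eq]
  rw [lintegral_tsum]
  · exact tsum_congr fun n => M.lintegral_reached π n (measurable_cost_section P π n)
  · exact fun n => (Measurable.ite (M.measurableSet_reached π n)
      ((measurable_cost_section P π n).comp ((M.measurable_past n).prodMk
        (M.measurable_sample n))) measurable_const).aemeasurable

/-- The throughput of a policy is at most `γ` when the net rewards at price `γ` of the feedbacks
it uses are dominated by a function whose mean does not exceed the price of contention. -/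
lemma throughput_le [IsProbabilityMeasure μ] {π : Policy} {r γ : ℝ} (hγ : 0 ≤ γ) (hγr : γ ≤ r)
    {B : ℝ → ℝ} (hB : Integrable B P.rateLaw)
    (h : ∀ n q k x, 0 ≤ x → P.reward γ r x (π.first n (q, k, x)) ≤ B x)
    (hBle : ∫ x, B x ∂P.rateLaw ≤ γ * (P.τ / P.ps)) (hπ : M.Admissible π) :
    M.throughput π r ≤ γ := by
  have hle : ∫⁻ ω, M.totalData π r ω ∂μ ≤ ENNReal.ofReal γ * ∫⁻ ω, M.totalTime π ω ∂μ := by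
    rw [M.lintegral_totalData, M.lintegral_totalTime, ← ENNReal.tsum_mul_left]
    refine ENNReal.tsum_le_tsum fun n => ?_
    rw [← lintegral_const_mul' _ _ ENNReal.ofReal_ne_top]
    exact lintegral_mono fun q => Params.lintegral_gain_le (π.measurable_firstRule n q)
      (π.measurable_secondRule n q) hγ hγr hB (h n q) hBle
  -- Admissibility enters here: a finite expected time is needed to take real values in the
  -- inequality.
  refine div_le_of_le_mul₀ ENNReal.toReal_nonneg hγ ?_
  rw [← ENNReal.toReal_ofReal hγ, ← ENNReal.toReal_mul]
  exact ENNReal.toReal_mono (ENNReal.mul_ne_top ENNReal.ofReal_ne_top hπ.ne) hle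

/-- Round `0` is always reached, and its contention already takes time. -/
lemma lintegral_totalTime_pos [IsProbabilityMeasure μ] (π : Policy) :
    0 < ∫⁻ ω, M.totalTime π ω ∂μ := by
  rw [M.lintegral_totalTime]
  refine lt_of_lt_of_le ?_ (ENNReal.le_tsum 0)
  have : π.waitSet 0 = Set.univ := rfl
  rw [this, Measure.restrict_univ]
  have hq : ∀ q : Fin 0 → ℕ × ℝ × ℝ, q = default := fun q => Subsingleton.elim _ _
  have e : (fun q : Fin 0 → ℕ × ℝ × ℝ =>
      ∫⁻ z, ENNReal.ofReal (P.cost (π.firstRule 0 q) (π.secondRule 0 q) z) ∂P.roundLaw) =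
      fun _ => ∫⁻ z, ENNReal.ofReal (P.cost (π.firstRule 0 default) (π.secondRule 0 default) z)
        ∂P.roundLaw := by
    funext q
    rw [hq q]
  have : IsProbabilityMeasure (μ.map (M.past 0)) :=
    Measure.isProbabilityMeasure_map (M.measurable_past 0).aemeasurable
  rw [e, lintegral_const, measure_univ, mul_one]
  exact Params.lintegral_cost_pos (π.measurable_firstRule 0 _) (π.measurable_secondRule 0 _)

/-- Only the balance of mean reward and contention price is used, not optimality of `xv`; with `xv =
r` this also gives the throughput of Strategy B. -/
lemma throughput_policyA [IsProbabilityMeasure μ] {r γ xv : ℝ} (hγ : 0 ≤ γ) (hγr : γ ≤ r)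
    (h : ∫ x, P.reward γ r x (feedbackA xv r x) ∂P.rateLaw = γ * (P.τ / P.ps))
    (hπ : M.Admissible (policyA xv r)) : M.throughput (policyA xv r) r = γ := by
  have heq : ∫⁻ ω, M.totalData (policyA xv r) r ω ∂μ =
      ENNReal.ofReal γ * ∫⁻ ω, M.totalTime (policyA xv r) ω ∂μ := by
    rw [M.lintegral_totalData, M.lintegral_totalTime, ← ENNReal.tsum_mul_left]
    refine tsum_congr fun n => ?_
    rw [← lintegral_const_mul' _ _ ENNReal.ofReal_ne_top]
    exact lintegral_congr fun q => Params.lintegral_gain_decide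
      ((policyA xv r).measurable_firstRule n q) hγ hγr
      (P.integrable_reward_feedbackA γ r xv) (fun k x _ => rfl) h
  rw [throughput, heq, ENNReal.toReal_mul, ENNReal.toReal_ofReal hγ]
  exact mul_div_cancel_right₀ _
    (ENNReal.toReal_pos (M.lintegral_totalTime_pos _).ne' hπ.ne).ne'

lemma measurable_R1 (n : ℕ) : Measurable (M.R1 n) :=
  ((M.measurable_h n).norm.pow_const 2).const_mul _

lemma map_R1 (n : ℕ) : μ.map (M.R1 n) = P.rateLaw := by
  have e : M.R1 n = (fun z : ℕ × ℂ × ℂ => P.a * ‖z.2.1‖ ^ 2) ∘ M.sample n := rfl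
  rw [e, ← Measure.map_map (by fun_prop) (M.measurable_sample n), M.map_sample, Params.rateLaw,
    Params.roundLaw]
  have e2 : (fun z : ℕ × ℂ × ℂ => P.a * ‖z.2.1‖ ^ 2) =
      (fun h : ℂ => P.a * ‖h‖ ^ 2) ∘ Prod.fst ∘ Prod.snd := rfl
  rw [e2, ← Measure.map_map (by fun_prop) (by fun_prop),
    ← Measure.map_map (by fun_prop) (by fun_prop), measurePreserving_snd.map_eq,
    measurePreserving_fst.map_eq]

lemma meanR1_eq : M.meanR1 = P.mean := by
  rw [meanR1, ← integral_map (f := fun x : ℝ => x) (M.measurable_R1 0).aemeasurable (by fun_prop), M.map_R1,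
    Params.rateLaw, integral_map (by fun_prop) (by fun_prop), integral_const_mul,
    integral_norm_sq_complexGaussian P.v_pos.le, Params.mean]

/-- A policy that transmits whenever `R⁽¹⁾ ≥ r`, and has the same rules in all rounds, has finite
expected total time. -/
lemma admissible_of_stationary [IsProbabilityMeasure μ] {π : Policy} {r : ℝ} (hr : 0 ≤ r)
    {f : ℕ × ℝ → Feedback} {s : ℕ × ℝ × ℝ → Bool} (hf : ∀ n q, π.firstRule n q = f)
    (hs : ∀ n q, π.secondRule n q = s) (hack : ∀ k x, r ≤ x → f (k, x) = .ack) :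
    M.Admissible π := by
  classical
  have hfm : Measurable f := by rw [← hf 0 default]; exact π.measurable_firstRule 0 default
  have hsm : Measurable s := by rw [← hs 0 default]; exact π.measurable_secondRule 0 default
  set ρ : ℝ≥0∞ := P.rateLaw (Set.Iio r) with hρ
  have hρ1 : ρ < 1 := by
    have h : P.rateLaw.real (Set.Ici r)ᶜ = 1 - Real.exp (-r / P.mean) := by
      rw [probReal_compl_eq_one_sub measurableSet_Ici, P.rateLaw_Ici hr]
    rw [Set.compl_Ici] at h
    rw [hρ, ← ENNReal.ofReal_toReal (measure_ne_top P.rateLaw (Set.Iio r)), ← measureReal_def, h,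
      ← ENNReal.ofReal_one, ENNReal.ofReal_lt_ofReal_iff one_pos]
    linarith [Real.exp_pos (-r / P.mean)]
  -- Continuing past round `n` forces `R⁽¹⁾ < r` there, an event of probability `ρ < 1` independent
  -- of the past; so the number of rounds has a geometric tail.
  have hstep : ∀ n, μ {ω | M.Reached π (n + 1) ω} ≤ ρ * μ {ω | M.Reached π n ω} := by
    intro n
    have hset : MeasurableSet {x : (Fin n → ℕ × ℝ × ℝ) × ℕ × ℂ × ℂ | P.a * ‖x.2.2.1‖ ^ 2 < r} :=
      measurableSet_lt (by fun_prop) measurable_const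
    have h1 := M.lintegral_reached π n (φ := Set.indicator
      {x : (Fin n → ℕ × ℝ × ℝ) × ℕ × ℂ × ℂ | P.a * ‖x.2.2.1‖ ^ 2 < r} 1)
      (measurable_one.indicator hset)
    have h2 : ∀ q : Fin n → ℕ × ℝ × ℝ, ∫⁻ z, (Set.indicator
        {x : (Fin n → ℕ × ℝ × ℝ) × ℕ × ℂ × ℂ | P.a * ‖x.2.2.1‖ ^ 2 < r} 1 (q, z))
        ∂P.roundLaw = ρ := by
      intro q
      have e3 : (fun z : ℕ × ℂ × ℂ => Set.indicator
        {x : (Fin n → ℕ × ℝ × ℝ) × ℕ × ℂ × ℂ | P.a * ‖x.2.2.1‖ ^ 2 < r}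
        (1 : (Fin n → ℕ × ℝ × ℝ) × ℕ × ℂ × ℂ → ℝ≥0∞) (q, z)) =
        fun z => (Set.Iio r).indicator 1 (P.a * ‖z.2.1‖ ^ 2) := rfl
      rw [e3, ← M.map_sample n, lintegral_map (f := fun z : ℕ × ℂ × ℂ =>
        (Set.Iio r).indicator (1 : ℝ → ℝ≥0∞) (P.a * ‖z.2.1‖ ^ 2))
        ((measurable_one.indicator measurableSet_Iio).comp (by fun_prop))
        (M.measurable_sample n), hρ, ← M.map_R1 n,
        ← lintegral_indicator_one measurableSet_Iio,
        lintegral_map (measurable_one.indicator measurableSet_Iio) (M.measurable_R1 n)]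
      rfl
    have h3 : ∫⁻ q in π.waitSet n, ρ ∂(μ.map (M.past n)) = ρ * μ {ω | M.Reached π n ω} := by
      rw [setLIntegral_const, Measure.map_apply (M.measurable_past n) (π.measurableSet_waitSet n)]
      congr 2
      ext ω
      exact (M.reached_iff π n ω).symm
    simp_rw [h2] at h1
    rw [← h3, ← h1, ← lintegral_indicator_one (M.measurableSet_reached π (n + 1))]
    refine lintegral_mono fun ω => ?_
    by_cases hω : M.Reached π (n + 1) ω
    · obtain ⟨h4, h5⟩ := (M.reached_succ_iff π n ω).1 hω
      have h6 : P.a * ‖(M.sample n ω).2.1‖ ^ 2 < r := by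
        by_contra h7
        refine h5 (Or.inl ?_)
        change π.firstRule n (M.past n ω) _ = _
        rw [hf]
        exact hack _ _ (not_lt.1 h7)
      simp [Set.indicator, hω, h4, h6]
    · simp [Set.indicator, hω]
  have hpow : ∀ n, μ {ω | M.Reached π n ω} ≤ ρ ^ n := by
    intro n
    induction n with
    | zero => exact prob_le_one.trans_eq (pow_zero ρ).symm
    | succ n ih =>
      rw [pow_succ']
      exact (hstep n).trans (mul_le_mul_right ih ρ)
  unfold Admissible
  rw [M.lintegral_totalTime]
  simp_rw [hf, hs, setLIntegral_const]
  have hle : ∀ n, (μ.map (M.past n)) (π.waitSet n) ≤ ρ ^ n := by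
    intro n
    rw [Measure.map_apply (M.measurable_past n) (π.measurableSet_waitSet n)]
    refine le_trans (measure_mono fun ω hω => ?_) (hpow n)
    exact (M.reached_iff π n ω).2 hω
  rw [ENNReal.tsum_mul_left]
  refine ENNReal.mul_lt_top (Params.lintegral_cost_ne_top hfm hsm).lt_top
    ((ENNReal.tsum_le_tsum hle).trans_lt ?_)
  rw [ENNReal.tsum_geometric]
  exact ENNReal.inv_lt_top.2 (tsub_pos_of_lt hρ1)

lemma admissible_policyA [IsProbabilityMeasure μ] {r : ℝ} (hr : 0 ≤ r) (xv : ℝ) :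
    M.Admissible (policyA xv r) :=
  M.admissible_of_stationary hr (f := fun o => feedbackA xv r o.2)
    (s := fun o => decide (r ≤ o.2.2)) (fun _ _ => rfl) (fun _ _ => rfl)
    fun k x hx => by simp [feedbackA, hx]

lemma admissible_policyB [IsProbabilityMeasure μ] {r : ℝ} (hr : 0 ≤ r) :
    M.Admissible (policyB r) :=
  M.admissible_of_stationary hr (f := fun o => feedbackB r o.2)
    (s := fun _ => false) (fun _ _ => rfl) (fun _ _ => rfl)
    fun k x hx => by simp [feedbackB, hx]

lemma feedbackB_ne_erasure (r x : ℝ) : feedbackB r x ≠ .erasure := by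
  unfold feedbackB
  split_ifs <;> simp

lemma firstFeedback_policyA_self (r : ℝ) (n : ℕ) (ω : Ω) :
    M.firstFeedback (policyA r r) n ω = M.firstFeedback (policyB r) n ω :=
  Params.feedbackA_self r (M.R1 n ω)

lemma firstFeedback_policyB_ne (r : ℝ) (n : ℕ) (ω : Ω) :
    M.firstFeedback (policyB r) n ω ≠ .erasure :=
  feedbackB_ne_erasure r (M.R1 n ω)

lemma reached_policyA_self (r : ℝ) (n : ℕ) (ω : Ω) :
    M.Reached (policyA r r) n ω ↔ M.Reached (policyB r) n ω := by
  simp [Reached, Transmits, firstFeedback_policyA_self, firstFeedback_policyB_ne]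

/-- Strategy A with equal thresholds is Strategy B. -/
lemma throughput_policyA_self (r r' : ℝ) :
    M.throughput (policyA r r) r' = M.throughput (policyB r) r' := by
  have h1 : M.totalData (policyA r r) r' = M.totalData (policyB r) r' := by
    funext ω
    simp only [totalData, roundData, firstFeedback_policyA_self]
    refine tsum_congr fun n => ?_
    have h := M.firstFeedback_policyB_ne r n ω
    have hR := M.reached_policyA_self r n ω
    by_cases hB : M.Reached (policyB r) n ω
    · cases hu : M.firstFeedback (policyB r) n ω
      · simp [hR, hB]
      · simp [hR, hB]
      · exact absurd hu h
    · simp [hR, hB]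
  have h2 : M.totalTime (policyA r r) = M.totalTime (policyB r) := by
    funext ω
    simp only [totalTime, roundTime, firstFeedback_policyA_self]
    refine tsum_congr fun n => ?_
    have h := M.firstFeedback_policyB_ne r n ω
    have hR := M.reached_policyA_self r n ω
    by_cases hB : M.Reached (policyB r) n ω
    · cases hu : M.firstFeedback (policyB r) n ω
      · simp [hR, hB]
      · simp [hR, hB]
      · exact absurd hu h
    · simp [hR, hB]
  rw [throughput, throughput, h1, h2]

end Probing

/-! ### Large transmission rates, and the closed form of one-level probing -/

namespace Params
variable (P : Params)

lemma integrable_R2 : Integrable (fun z : ℂ × ℂ => P.b * ‖z.1 + z.2‖ ^ 2)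
    ((complexGaussian P.v).prod (complexGaussian P.w)) := by
  have h1 := (integrable_norm_sq_complexGaussian P.v).comp_fst (complexGaussian P.w)
  have h2 := (integrable_norm_sq_complexGaussian P.w).comp_snd (complexGaussian P.v)
  refine Integrable.const_mul (((h1.add h2).const_mul 2).mono' (by fun_prop)
    (Filter.Eventually.of_forall fun z => ?_)) P.b
  rw [Real.norm_of_nonneg (sq_nonneg _)]
  have := pow_le_pow_left₀ (norm_nonneg _) (norm_add_le z.1 z.2) 2
  simp only [Pi.add_apply]
  nlinarith [sq_nonneg (‖z.1‖ - ‖z.2‖)]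

/-- At a positive price, the net reward of a round becomes negative for large rates. -/
lemma eventually_netReward_neg {c : ℝ} (hc : 0 < c) :
    ∀ᶠ r in Filter.atTop, P.netReward c r < 0 := by
  set ν := (complexGaussian P.v).prod (complexGaussian P.w) with hν
  let R1 : ℂ × ℂ → ℝ := fun z => P.a * ‖z.1‖ ^ 2
  let R2 : ℂ × ℂ → ℝ := fun z => P.b * ‖z.1 + z.2‖ ^ 2
  have hR1 : Measurable R1 := by fun_prop
  have hR2 : Measurable R2 := by fun_prop
  have hR1n : ∀ z, 0 ≤ R1 z := fun z => mul_nonneg P.a_pos.le (sq_nonneg _)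
  have hR2n : ∀ z, 0 ≤ R2 z := fun z => mul_nonneg P.b_pos.le (sq_nonneg _)
  have hR1i : Integrable R1 ν :=
    ((integrable_norm_sq_complexGaussian P.v).const_mul P.a).comp_fst (complexGaussian P.w)
  have hR2i : Integrable R2 ν := P.integrable_R2
  have hm1 : ∀ r, MeasurableSet {z | r ≤ R1 z} := fun r => measurableSet_le measurable_const hR1
  have hm2 : ∀ r, MeasurableSet {z | r ≤ R2 z} := fun r => measurableSet_le measurable_const hR2
  -- The tails of both rates. Their mean tends to `0` and bounds that of the best reward: "1" earns
  -- at most `R⁽¹⁾` on `R⁽¹⁾ ≥ r`, and `V ≤ r P(R⁽²⁾ ≥ r | R⁽¹⁾)`, which is handled as in Markov's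
  -- inequality.
  let T : ℝ → ℂ × ℂ → ℝ := fun r z =>
    {z | r ≤ R1 z}.indicator R1 z + {z | r ≤ R2 z}.indicator R2 z
  have hTi : ∀ r, Integrable (T r) ν := fun r =>
    (hR1i.indicator (hm1 r)).add (hR2i.indicator (hm2 r))
  have hlim : Filter.Tendsto (fun r => ∫ z, T r z ∂ν) Filter.atTop (nhds (∫ _, (0 : ℝ) ∂ν)) := by
    refine tendsto_integral_filter_of_dominated_convergence (fun z => R1 z + R2 z)
      (Filter.Eventually.of_forall fun r => (hTi r).aestronglyMeasurable)
      (Filter.Eventually.of_forall fun r => Filter.Eventually.of_forall fun z => ?_)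
      (hR1i.add hR2i) (Filter.Eventually.of_forall fun z => ?_)
    · refine (norm_add_le _ _).trans (add_le_add ?_ ?_)
      · exact (norm_indicator_le_norm_self _ _).trans_eq (Real.norm_of_nonneg (hR1n z))
      · exact (norm_indicator_le_norm_self _ _).trans_eq (Real.norm_of_nonneg (hR2n z))
    · refine (tendsto_const_nhds (x := (0 : ℝ))).congr' ?_
      filter_upwards [Filter.eventually_gt_atTop (R1 z), Filter.eventually_gt_atTop (R2 z)]
        with r h1 h2
      simp [T, Set.indicator, not_le.2 h1, not_le.2 h2]
  rw [integral_zero] at hlim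
  have hcq : 0 < c * (P.τ / P.ps) := mul_pos hc (div_pos P.τ_pos P.ps_real_pos)
  filter_upwards [hlim.eventually_lt_const hcq, Filter.eventually_ge_atTop c] with r hr hcr
  have hr0 : 0 ≤ r := hc.le.trans hcr
  suffices h : ∫ x, P.bestReward c r x ∂P.rateLaw ≤ ∫ z, T r z ∂ν by
    simp only [netReward]
    linarith
  have hGi : Integrable (fun x => r * (1 - P.G r x)) P.rateLaw :=
    (P.integrable_one_sub_G r).const_mul r
  have hAi : Integrable (fun x => (Set.Ici r).indicator (fun x => x) x) P.rateLaw := by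
    refine (integrable_map_measure (by fun_prop) (by fun_prop)).2 ?_ |>.indicator measurableSet_Ici
    exact (integrable_norm_sq_complexGaussian P.v).const_mul P.a
  have hpt : ∀ᵐ x ∂P.rateLaw,
      P.bestReward c r x ≤ (Set.Ici r).indicator (fun x => x) x + r * (1 - P.G r x) := by
    filter_upwards [P.ae_rateLaw_nonneg] with x hx
    have h1 : 0 ≤ (Set.Ici r).indicator (fun x : ℝ => x) x := Set.indicator_nonneg (fun _ h =>
      hr0.trans h) x
    have h2 : 0 ≤ r * (1 - P.G r x) := mul_nonneg hr0 (by linarith [P.G_le_one r x])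
    refine max_le (max_le (by linarith) ?_) ?_
    · by_cases h : r ≤ x
      · simp only [h, if_true, Set.indicator, Set.mem_Ici]
        linarith
      · simp only [h, if_false]
        linarith
    · have h3 := P.V_le hc.le hcr x
      have h4 : 0 ≤ c * (1 - P.G r x) := mul_nonneg hc.le (by linarith [P.G_le_one r x])
      linarith
  refine (integral_mono_ae (P.integrable_bestReward hc.le hr0) (hAi.add hGi) hpt).trans ?_
  rw [integral_add' hAi hGi, integral_add (hR1i.indicator (hm1 r)) (hR2i.indicator (hm2 r))]
  refine add_le_add (le_of_eq ?_) ?_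
  · rw [rateLaw, integral_map (f := (Set.Ici r).indicator fun x => x) (by fun_prop)
      (measurable_id'.indicator measurableSet_Ici).aestronglyMeasurable]
    have := integral_fun_fst (μ := complexGaussian P.v) (ν := complexGaussian P.w)
      (fun h => (Set.Ici r).indicator (fun x => x) (P.a * ‖h‖ ^ 2))
    rw [probReal_univ, one_smul] at this
    rw [← this]
    rfl
  · rw [rateLaw, integral_map (by fun_prop)
      (((P.measurable_G r).const_sub 1).const_mul r).aestronglyMeasurable]
    have hci : Integrable ({z | r ≤ R2 z}.indicator fun _ => r) ν :=
      (integrable_const r).indicator (hm2 r)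
    have e : ∫ h, r * (1 - P.G r (P.a * ‖h‖ ^ 2)) ∂complexGaussian P.v =
        ∫ z, {z | r ≤ R2 z}.indicator (fun _ => r) z ∂ν := by
      rw [hν, integral_prod _ hci]
      refine integral_congr_ae (Filter.Eventually.of_forall fun h => ?_)
      exact (integral_indicator_R2 P r r h).symm
    rw [e]
    refine integral_mono hci (hR2i.indicator (hm2 r)) fun z => ?_
    by_cases h : r ≤ R2 z <;> simp [Set.indicator, h]

/-- The optimal throughput of one-level probing, in closed form. -/
def oneRate (r : ℝ) : ℝ :=
  r * Real.exp (-r / P.mean) / (P.τ / P.ps + Real.exp (-r / P.mean))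

/-- The right-hand side is the balance equation of Strategy B: mean reward equals price of
contention. -/
lemma oneRate_eq_iff {r γ : ℝ} :
    γ = P.oneRate r ↔ (r - γ) * Real.exp (-r / P.mean) = γ * (P.τ / P.ps) := by
  have h : 0 < P.τ / P.ps + Real.exp (-r / P.mean) :=
    add_pos (div_pos P.τ_pos P.ps_real_pos) (Real.exp_pos _)
  rw [oneRate, eq_div_iff h.ne']
  constructor <;> intro h <;> linarith

lemma oneRate_pos {r : ℝ} (hr : 0 < r) : 0 < P.oneRate r :=
  div_pos (mul_pos hr (Real.exp_pos _))
    (add_pos (div_pos P.τ_pos P.ps_real_pos) (Real.exp_pos _))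

lemma oneRate_lt {r : ℝ} (hr : 0 < r) : P.oneRate r < r := by
  have h := P.oneRate_eq_iff.1 (rfl : P.oneRate r = P.oneRate r)
  have h1 := mul_pos (P.oneRate_pos hr) (div_pos P.τ_pos P.ps_real_pos)
  rw [← h] at h1
  exact sub_pos.1 (pos_of_mul_pos_left h1 (Real.exp_pos _).le)

lemma integral_reward_feedbackB {γ r : ℝ} (hr : 0 ≤ r) :
    ∫ x, P.reward γ r x (feedbackB r x) ∂P.rateLaw = (r - γ) * Real.exp (-r / P.mean) := by
  simp_rw [← feedbackA_self]
  rw [P.integral_reward_feedbackA hr le_rfl, probeIntegral]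
  simp

lemma integrable_reward_feedbackB (γ r : ℝ) :
    Integrable (fun x => P.reward γ r x (feedbackB r x)) P.rateLaw := by
  simp_rw [← feedbackA_self]
  exact P.integrable_reward_feedbackA γ r r

lemma reward_le_feedbackB {γ r : ℝ} (hγ : 0 ≤ γ) (hγr : γ ≤ r) (x : ℝ) {u : Feedback}
    (hu : u ≠ .erasure) : P.reward γ r x u ≤ P.reward γ r x (feedbackB r x) := by
  unfold feedbackB
  by_cases h : r ≤ x
  · cases u
    · simp [h, reward, hγr]
    · simp [h]
    · exact absurd rfl hu
  · cases u
    · simp [h]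
    · simp [h, reward, hγ]
    · exact absurd rfl hu

/-- Strict optimality of the rate solving the transcendental equation, for one-level probing. -/
lemma oneRate_lt_oneRate {R r : ℝ}
    (hR : (R / P.mean - 1) * Real.exp (R / P.mean) = P.ps / P.τ) (hr : r ≠ R) :
    P.oneRate r < P.oneRate R := by
  have hm := P.mean_pos
  have hp := P.ps_real_pos
  have hτ := P.τ_pos
  have hq : 0 < P.τ / P.ps := div_pos hτ hp
  have key : (R - P.mean) * (P.τ / P.ps) = P.mean * Real.exp (-R / P.mean) := by
    have h1 : Real.exp (-R / P.mean) * Real.exp (R / P.mean) = 1 := by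
      rw [← Real.exp_add, neg_div, neg_add_cancel, Real.exp_zero]
    have h2 : R / P.mean - 1 = P.ps / P.τ * Real.exp (-R / P.mean) := by
      rw [← hR, mul_assoc, mul_comm (Real.exp (R / P.mean)), h1, mul_one]
    have h3 : R - P.mean = P.mean * (R / P.mean - 1) := by field_simp
    rw [h3, h2]
    field_simp
  -- The transcendental equation says exactly that the throughput at `R` is `R - mean`.
  have hRm : R - P.mean = P.oneRate R := by
    refine P.oneRate_eq_iff.2 ?_
    rw [key]
    ring
  rw [← hRm, oneRate, div_lt_iff₀ (add_pos hq (Real.exp_pos _)), mul_add, key]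
  have h4 : Real.exp (-R / P.mean) = Real.exp ((r - R) / P.mean) * Real.exp (-r / P.mean) := by
    rw [← Real.exp_add]
    congr 1
    ring
  rw [h4]
  -- With `t = (r - R) / mean`, the claim has become `1 + t < exp t`, strict since `t ≠ 0`.
  have h5 : (r - R) / P.mean + 1 < Real.exp ((r - R) / P.mean) :=
    Real.add_one_lt_exp (div_ne_zero (sub_ne_zero.2 hr) hm.ne')
  have h6 : r - R + P.mean < P.mean * Real.exp ((r - R) / P.mean) := by
    calc r - R + P.mean = P.mean * ((r - R) / P.mean + 1) := by field_simp
      _ < _ := mul_lt_mul_of_pos_left h5 hm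
  have h7 := mul_lt_mul_of_pos_right h6 (Real.exp_pos (-r / P.mean))
  linarith

lemma exists_hatRate :
    ∃ R, 0 < R ∧ (R / P.mean - 1) * Real.exp (R / P.mean) = P.ps / P.τ := by
  have hm := P.mean_pos
  have hc : 0 < P.ps / P.τ := div_pos P.ps_real_pos P.τ_pos
  set c := P.ps / P.τ
  -- In the variable `u = R / mean`, the left side is `0` at `u = 1` and `c exp (1 + c) ≥ c` at `u =
  -- 1 + c`.
  have hcont : ContinuousOn (fun u : ℝ => (u - 1) * Real.exp u) (Set.Icc 1 (1 + c)) := by fun_prop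
  obtain ⟨u, hu, he⟩ := intermediate_value_Icc (by linarith : (1 : ℝ) ≤ 1 + c) hcont
    (show c ∈ Set.Icc _ _ by
      refine ⟨by simp [hc.le], ?_⟩
      have : 1 ≤ Real.exp (1 + c) := Real.one_le_exp (by linarith)
      simp only [add_sub_cancel_left]
      nlinarith)
  refine ⟨u * P.mean, mul_pos (by linarith [hu.1]) hm, ?_⟩
  rw [mul_div_cancel_right₀ _ hm.ne']
  exact he

lemma netReward_congr {γ r xv : ℝ}
    (h : ∀ x, 0 ≤ x → P.reward γ r x (feedbackA xv r x) = P.bestReward γ r x) :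
    ∫ x, P.reward γ r x (feedbackA xv r x) ∂P.rateLaw = ∫ x, P.bestReward γ r x ∂P.rateLaw :=
  integral_congr_ae (P.ae_rateLaw_nonneg.mono h)

lemma probeIntegral_nonneg (xv r : ℝ) : 0 ≤ P.probeIntegral xv r :=
  integral_nonneg fun x => by simpa using P.G_le_one r x

end Params

/-! ### Optimal throughput at a fixed rate, and existence of an optimal rate -/

namespace Probing

variable {P : Params} {Ω : Type*} [MeasurableSpace Ω] {μ : Measure Ω} [IsProbabilityMeasure μ]
  (M : Probing P μ)

lemma isGreatest_achievable {γ r : ℝ} (hγ : 0 < γ) (hγr : γ < r) (h : P.netReward γ r = 0) :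
    IsGreatest (M.achievable r) γ := by
  have hr := hγ.trans hγr
  have h' : ∫ x, P.bestReward γ r x ∂P.rateLaw = γ * (P.τ / P.ps) := by
    simp only [Params.netReward] at h
    linarith
  constructor
  · obtain ⟨xv, -, -, hx⟩ := P.exists_feedbackA_optimal hr hγ hγr
    exact ⟨policyA xv r, M.admissible_policyA hr.le xv, M.throughput_policyA hγ.le hγr.le
      ((P.netReward_congr hx).trans h') (M.admissible_policyA hr.le xv)⟩
  · rintro _ ⟨π, hπ, rfl⟩
    exact M.throughput_le hγ.le hγr.le (P.integrable_bestReward hγ.le hr.le)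
      (fun n q k x _ => P.reward_le_bestReward γ r x _) h'.le hπ

lemma gammaStar_spec {r : ℝ} (hr : 0 < r) :
    0 < M.gammaStar r ∧ M.gammaStar r < r ∧ P.netReward (M.gammaStar r) r = 0 ∧
      IsGreatest (M.achievable r) (M.gammaStar r) := by
  obtain ⟨γ, h0, h1, h2⟩ := P.exists_netReward_eq_zero hr
  have h := M.isGreatest_achievable h0 h1 h2
  have e : M.gammaStar r = γ := h.csSup_eq
  rw [e]
  exact ⟨h0, h1, h2, h⟩

/-- The pricing argument again, with the reward of Strategy B as dominating function, since it is
the better of "0" and "1". -/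
lemma isGreatest_achievableOne {r : ℝ} (hr : 0 < r) :
    IsGreatest (M.achievableOne r) (P.oneRate r) := by
  have hγ := P.oneRate_pos hr
  have hγr := P.oneRate_lt hr
  have h := P.oneRate_eq_iff.1 (rfl : P.oneRate r = P.oneRate r)
  rw [← P.integral_reward_feedbackB hr.le] at h
  constructor
  · refine ⟨policyB r, fun n x => feedbackB_ne_erasure r x.2.2, M.admissible_policyB hr.le, ?_⟩
    rw [← throughput_policyA_self]
    simp_rw [← Params.feedbackA_self] at h
    exact M.throughput_policyA hγ.le hγr.le h (M.admissible_policyA hr.le r)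
  · rintro _ ⟨π, hπe, hπ, rfl⟩
    exact M.throughput_le hγ.le hγr.le (P.integrable_reward_feedbackB _ r)
      (fun n q k x _ => P.reward_le_feedbackB hγ.le hγr.le x (hπe n _)) h.le hπ

lemma gammaHat_eq {r : ℝ} (hr : 0 < r) : M.gammaHat r = P.oneRate r :=
  (M.isGreatest_achievableOne hr).csSup_eq

lemma throughput_policyB {r : ℝ} (hr : 0 < r) : M.throughput (policyB r) r = M.gammaHat r := by
  have h := P.oneRate_eq_iff.1 (rfl : P.oneRate r = P.oneRate r)
  rw [← P.integral_reward_feedbackB hr.le] at h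
  simp_rw [← Params.feedbackA_self] at h
  rw [M.gammaHat_eq hr, ← throughput_policyA_self]
  exact M.throughput_policyA (P.oneRate_pos hr).le (P.oneRate_lt hr).le h
    (M.admissible_policyA hr.le r)

lemma gammaHat_le_gammaStar {r : ℝ} (hr : 0 < r) : M.gammaHat r ≤ M.gammaStar r := by
  obtain ⟨π, -, h1, h2⟩ := (M.isGreatest_achievableOne hr).1
  rw [M.gammaHat_eq hr]
  exact (M.gammaStar_spec hr).2.2.2.2 ⟨π, h1, h2⟩

/-- Comparing `γ*(r)` with a fixed `c` becomes a sign condition on `netReward c r`, which is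
continuous in `r`; this yields the continuity of `γ*`. -/
lemma gammaStar_lt_iff {r c : ℝ} (hr : 0 < r) (hc : 0 ≤ c) :
    M.gammaStar r < c ↔ P.netReward c r < 0 := by
  obtain ⟨h0, -, h, -⟩ := M.gammaStar_spec hr
  rw [← h]
  exact ((P.netReward_strictAntiOn hr.le).lt_iff_gt hc h0.le).symm

lemma lt_gammaStar_iff {r c : ℝ} (hr : 0 < r) (hc : 0 ≤ c) :
    c < M.gammaStar r ↔ 0 < P.netReward c r := by
  obtain ⟨h0, -, h, -⟩ := M.gammaStar_spec hr
  rw [← h]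
  exact ((P.netReward_strictAntiOn hr.le).lt_iff_gt h0.le hc).symm

lemma continuousOn_gammaStar : ContinuousOn M.gammaStar (Set.Ioi 0) := by
  intro r hr
  refine ContinuousAt.continuousWithinAt (tendsto_order.2 ⟨fun c hc => ?_, fun c hc => ?_⟩)
  · rcases lt_or_ge c 0 with h0 | h0
    · filter_upwards [Ioi_mem_nhds hr] with r' hr'
      exact h0.trans (M.gammaStar_spec hr').1
    · filter_upwards [Ioi_mem_nhds hr, (P.continuousAt_netReward h0 hr).eventually_const_lt
        ((M.lt_gammaStar_iff hr h0).1 hc)] with r' hr' h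
      exact (M.lt_gammaStar_iff hr' h0).2 h
  · have h0 : 0 ≤ c := (M.gammaStar_spec hr).1.le.trans hc.le
    filter_upwards [Ioi_mem_nhds hr, (P.continuousAt_netReward h0 hr).eventually_lt_const
      ((M.gammaStar_lt_iff hr h0).1 hc)] with r' hr' h
    exact (M.gammaStar_lt_iff hr' h0).2 h

/-- With `c = γ*(1)`, rates below `c` give less than `c` because `γ*(r) < r`, and so do large rates
because `netReward c r < 0`; a compact interval containing `1` remains. -/
lemma exists_isMaxOn_gammaStar : ∃ R, 0 < R ∧ IsMaxOn M.gammaStar (Set.Ioi 0) R := by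
  obtain ⟨h0, h1, -, -⟩ := M.gammaStar_spec one_pos
  set c := M.gammaStar 1
  obtain ⟨A, hA⟩ := Filter.eventually_atTop.1 (P.eventually_netReward_neg h0)
  obtain ⟨R, hR, hmax⟩ := isCompact_Icc.exists_isMaxOn
    (s := Set.Icc c (max A 1)) ⟨1, h1.le, le_max_right _ _⟩
    (M.continuousOn_gammaStar.mono fun x hx => h0.trans_le hx.1)
  have hcR : c ≤ M.gammaStar R := hmax ⟨h1.le, le_max_right _ _⟩
  refine ⟨R, h0.trans_le hR.1, fun r hr => ?_⟩
  have hr : 0 < r := hr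
  rcases lt_or_ge r c with h | h
  · exact ((M.gammaStar_spec hr).2.1.le.trans h.le).trans hcR
  rcases le_or_gt r (max A 1) with h' | h'
  · exact hmax ⟨h, h'⟩
  · exact ((M.gammaStar_lt_iff hr h0.le).2 (hA r ((le_max_left _ _).trans h'.le))).le.trans hcR

lemma isGreatest_achievableAll {R : ℝ} (hR : 0 < R) (hmax : IsMaxOn M.gammaStar (Set.Ioi 0) R) :
    IsGreatest M.achievableAll (M.gammaStar R) := by
  refine ⟨⟨R, hR, (M.gammaStar_spec hR).2.2.2.1⟩, ?_⟩
  rintro x ⟨r, hr, hx⟩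
  exact ((M.gammaStar_spec hr).2.2.2.2 hx).trans (hmax hr)

/-! ### The two strategies at an optimal rate -/

lemma strategyAOptimal {R : ℝ} (hR : 0 < R) (hmax : IsMaxOn M.gammaStar (Set.Ioi 0) R)
    (hV : 0 ≤ P.V (M.gammaStar R) R R) : ∃ xv, M.StrategyAOptimal xv R := by
  obtain ⟨h0, h1, h2, -⟩ := M.gammaStar_spec hR
  obtain ⟨xv, hx0, hxR, hiff, hcross⟩ := P.exists_threshold hR h1 hV
  have hbest : ∀ x, 0 ≤ x → P.reward (M.gammaStar R) R x (feedbackA xv R x) =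
      P.bestReward (M.gammaStar R) R x := fun x hx =>
    P.reward_feedbackA h0 h1.le
      (fun x hx hxv => le_of_not_ge fun h => absurd ((hiff x hx).1 h) (not_le.2 hxv))
      (fun x hxv _ => (hiff x (hx0.trans hxv)).2 hxv) hx
  have hint : ∫ x, P.reward (M.gammaStar R) R x (feedbackA xv R x) ∂P.rateLaw =
      M.gammaStar R * (P.τ / P.ps) := by
    rw [P.netReward_congr hbest]
    simp only [Params.netReward] at h2
    linarith
  refine ⟨xv, hx0, hxR, hiff, hcross, fun x hx u => ?_, M.admissible_policyA hR.le xv,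
    M.throughput_policyA h0.le h1.le hint (M.admissible_policyA hR.le xv),
    M.isGreatest_achievableAll hR hmax, ?_⟩
  · rw [hbest x hx]
    exact P.reward_le_bestReward _ _ _ _
  -- The throughput formula is the balance equation `hint`, linear in `γ`, solved for `γ`.
  · have hI := P.probeIntegral_nonneg xv R
    rw [P.integral_reward_feedbackA hx0 hxR] at hint
    simp only [M.map_R1, M.meanR1_eq]
    change _ = ((1 - P.τ) * R * P.probeIntegral xv R + _) /
      ((1 - P.τ) * (P.probeIntegral xv R + _) + _)
    have hτ := P.τ_lt_one
    have hp := P.ps_real_pos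
    have hτ0 := P.τ_pos
    have hτ1 : 0 < 1 - P.τ := by linarith
    rw [eq_div_iff (by positivity)]
    have e : P.τ * (1 / (P.ps : ℝ)) = P.τ / P.ps := by ring
    rw [mul_add P.τ, e]
    linarith

lemma strategyBOptimal {R Rhat : ℝ} (hR : 0 < R) (hmax : IsMaxOn M.gammaStar (Set.Ioi 0) R)
    (hV : P.V (M.gammaStar R) R R < 0) (hhat : M.IsHatRate Rhat) :
    R = Rhat ∧ M.StrategyBOptimal Rhat := by
  obtain ⟨h0, h1, h2, -⟩ := M.gammaStar_spec hR
  obtain ⟨hhat0, hhat⟩ := hhat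
  rw [M.meanR1_eq] at hhat
  have hlow : ∀ x, 0 ≤ x → x ≤ R → P.V (M.gammaStar R) x R < 0 := fun x hx hxR =>
    ((P.V_strictMonoOn hR h1).monotoneOn hx hR.le hxR).trans_lt hV
  have hbest : ∀ x, 0 ≤ x → P.reward (M.gammaStar R) R x (feedbackB R x) =
      P.bestReward (M.gammaStar R) R x := fun x hx => by
    rw [← Params.feedbackA_self]
    exact P.reward_feedbackA h0 h1.le (fun x hx hxR => (hlow x hx hxR.le).le)
      (fun x h h' => absurd h' (not_lt.2 h)) hx
  have hone : M.gammaStar R = P.oneRate R := by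
    refine P.oneRate_eq_iff.2 ?_
    rw [← P.integral_reward_feedbackB hR.le,
      integral_congr_ae (P.ae_rateLaw_nonneg.mono hbest)]
    simp only [Params.netReward] at h2
    linarith
  -- Otherwise `γ*(R) = γ̂(R) < γ̂(Rhat) ≤ γ*(Rhat) ≤ γ*(R)`.
  have hRR : R = Rhat := by
    by_contra hne
    have h3 := P.oneRate_lt_oneRate hhat hne
    have h4 := M.gammaHat_le_gammaStar hhat0
    rw [M.gammaHat_eq hhat0] at h4
    have h5 : M.gammaStar Rhat ≤ M.gammaStar R := hmax hhat0
    linarith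
  subst hRR
  have hγ : M.gammaHat R = M.gammaStar R := by rw [M.gammaHat_eq hR, hone]
  refine ⟨rfl, fun x hx => ?_, fun x hx u => ?_, M.admissible_policyB hR.le,
    M.throughput_policyB hR, ?_⟩
  · rw [hγ]
    unfold feedbackB
    by_cases h : R ≤ x
    · simpa [h, Params.reward] using P.V_lt h0 h1.le x
    · simpa [h, Params.reward] using hlow x hx (not_le.1 h).le
  · rw [hγ, hbest x hx]
    exact P.reward_le_bestReward _ _ _ _
  · rw [hγ]
    exact M.isGreatest_achievableAll hR hmax

end Probing

end DOS

end

theorem theorem3 (P : DOS.Params) {Ω : Type*} [MeasurableSpace Ω] (μ : MeasureTheory.Measure Ω)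
    [MeasureTheory.IsProbabilityMeasure μ] (M : DOS.Probing P μ) :
    ∃ Rhat : ℝ,
      -- the one-level parameters
      M.IsHatRate Rhat ∧ (∀ r, M.IsHatRate r → r = Rhat) ∧
      IsMaxOn M.gammaHat (Set.Ioi 0) Rhat ∧
      M.gammaHat Rhat = Rhat * Real.exp (-Rhat / M.meanR1) /
        (P.τ / (P.ps : ℝ) + Real.exp (-Rhat / M.meanR1)) ∧
      -- an optimal transmission rate exists
      (∃ Rstar : ℝ, 0 < Rstar ∧ IsMaxOn M.gammaStar (Set.Ioi 0) Rstar) ∧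
      -- at each of them, the optimal strategy has one of the two forms
      (∀ Rstar : ℝ, 0 < Rstar → IsMaxOn M.gammaStar (Set.Ioi 0) Rstar →
        (∃ xv : ℝ, M.StrategyAOptimal xv Rstar) ∨
        (Rstar = Rhat ∧ M.StrategyBOptimal Rhat)) := by
  obtain ⟨R, hR, he⟩ := P.exists_hatRate
  have hhat : M.IsHatRate R := ⟨hR, by rwa [M.meanR1_eq]⟩
  refine ⟨R, hhat, fun r hr => ?_, fun r hr => ?_, ?_, M.exists_isMaxOn_gammaStar,
    fun S hS hmax => ?_⟩
  -- Of two distinct solutions, each would be strictly better than the other for one-level probing.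
  · by_contra hne
    obtain ⟨-, hr⟩ := hr
    rw [M.meanR1_eq] at hr
    exact lt_asymm (P.oneRate_lt_oneRate he hne) (P.oneRate_lt_oneRate hr (Ne.symm hne))
  · have hr : 0 < r := hr
    change M.gammaHat r ≤ M.gammaHat R
    rw [M.gammaHat_eq hr, M.gammaHat_eq hR]
    rcases eq_or_ne r R with rfl | hne
    · exact le_rfl
    · exact (P.oneRate_lt_oneRate he hne).le
  · rw [M.gammaHat_eq hR, M.meanR1_eq, DOS.Params.oneRate]
  -- As `V` increases in `x`, its sign at `x = S` tells whether probing can pay anywhere below `S`.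
  · rcases le_or_gt 0 (P.V (M.gammaStar S) S S) with hV | hV
    · exact Or.inl (M.strategyAOptimal hS hmax hV)
    · exact Or.inr (M.strategyBOptimal hS hmax hV hhat)
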